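/- For a finite poset $P$, let $J(P)$ be the lattice of order ideals of $P$ ordered by inclusion, and for $I\in J(P)$ let $\mathrm{ddeg}(I)$ be the number of elements of $J(P)$ covered by $I$. For $p\in P$ let $\tau_p\colon J(P)\to J(P)$ be the toggle at $p$: $\tau_p(I)=I\cup\{p\}$ if $p\notin I$ and $I\cup\{p\}$ is an order ideal, $\tau_p(I)=I\setminus\{p\}$ if $p\in I$ and $I\setminus\{p\}$ is an order ideal, and $\tau_p(I)=I$ otherwise. Let $\mathcal{T}_p(I)=1$ if $I\subsetneq\tau_p(I)$, $\mathcal{T}_p(I)=-1$ if $\tau_p(I)\subsetneq I$, and $\mathcal{T}_p(I)=0$ otherwise. A probability distribution $\mu$ on $J(P)$ is toggle-symmetric if $\mathbb{E}(\mu;\mathcal{T}_p)=0$ for all $p\in P$. The lattice $J(P)$ is tCDE if $\mathbb{E}(\mu;\mathrm{ddeg})=\mathbb{E}(\mathrm{uni}_{J(P)};\mathrm{ddeg})$ for every toggle-symmetric distribution $\mu$ on $J(P)$, where $\mathrm{uni}_{J(P)}$ is the uniform distribution. **Theorem.** Let $P$ be a root poset of coincidental type. Then $J(P)$ is tCDE.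 Explicitly, $J(P)$ is tCDE in each of the following cases. 1. $P=\Phi^+$ is the set of positive roots, with respect to any choice of simple roots $\alpha_1,\dots,\alpha_n$, of an irreducible crystallographic (reduced, finite, real) root system $\Phi$ of type $A_n$, $B_n$, $C_n$ or $G_2$, ordered by $\alpha\le\beta$ if and only if $\beta-\alpha=\sum_i a_i\alpha_i$ with all $a_i\ge 0$. 2. $P=\Phi^+(H_3)$, the poset on $\{0,1,\dots,14\}$ whose covering relations are $0,1\lessdot 3$; $1,2\lessdot 4$; $3,4\lessdot 5$; $4\lessdot 6$; $5,6\lessdot 7$; $6\lessdot 8$; $7\lessdot 9$; $7,8\lessdot 10$; $9,10\lessdot 11\lessdot 12\lessdot 13\lessdot 14$. 3. $P=\Phi^+(I_2(m))$ with $m\ge 2$, the poset on $\{0,1,\dots,m-1\}$ in which $0$ and $1$ are incomparable and both lie below the chain $2<3<\dots<m-1$. Moreover, the following identities of functions on $J(P)$ hold. For $P=\Phi^+(H_3)$, $$2\cdot\mathrm{ddeg}+\sum_{p\in P}c_p\mathcal{T}_p=3,\qquad (c_0,\dots,c_{14})=(1,1,1,0,0,-1,0,-2,0,-1,-2,-4,-3,-2,-1),$$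 and for $P=\Phi^+(I_2(m))$ with $m\ge2$, where $a,b$ are its two minimal elements, $$2\cdot\mathrm{ddeg}+\mathcal{T}_a+\mathcal{T}_b=2.$$ -/

import Mathlib

/-! Toggle CDE distributive lattices and root posets of coincidental type. -/

namespace RootPosetCDE

/-! ### The toggle CDE property -/

/-- The down-degree of `x`: the number of elements that `x` covers. -/
noncomputable def ddeg {L : Type*} [Preorder L] (x : L) : ℕ :=
  Nat.card {y : L // y ⋖ x}

/-- A probability distribution on a finite set. -/
def IsProbDist {X : Type*} [Finite X] (μ : X → ℝ) : Prop :=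
  (∀ x, 0 ≤ μ x) ∧ ∑ᶠ x, μ x = 1

/-- The expected value of the statistic `f` with respect to the distribution `μ`. -/
noncomputable def expect {X : Type*} [Finite X] (μ f : X → ℝ) : ℝ :=
  ∑ᶠ x, μ x * f x

/-- The uniform distribution on a finite set. -/
noncomputable def uniform (X : Type*) [Finite X] : X → ℝ :=
  fun _ => 1 / (Nat.card X : ℝ)

section Toggle

variable {P : Type*} [PartialOrder P]

open Classical in
/-- The toggle at `p`, acting on the order ideals of `P`. -/
noncomputable def toggle (p : P) (I : LowerSet P) : LowerSet P :=
  if h : p ∉ I ∧ IsLowerSet (insert p (I : Set P)) then ⟨insert p (I : Set P), h.2⟩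
  else if h : p ∈ I ∧ IsLowerSet ((I : Set P) \ {p}) then ⟨(I : Set P) \ {p}, h.2⟩
  else I

open Classical in
/-- Whether `p` can be toggled into `I`. -/
noncomputable def toggleIn (p : P) (I : LowerSet P) : ℤ :=
  if I < toggle p I then 1 else 0

open Classical in
/-- Whether `p` can be toggled out of `I`. -/
noncomputable def toggleOut (p : P) (I : LowerSet P) : ℤ :=
  if toggle p I < I then 1 else 0

/-- The toggleability statistic at `p`. -/
noncomputable def toggleability (p : P) (I : LowerSet P) : ℤ :=
  toggleIn p I - toggleOut p I

/-- A probability distribution on the order ideals of `P` is toggle-symmetric if every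
toggleability statistic has expected value zero. -/
def IsToggleSymmetric [Finite P] (μ : LowerSet P → ℝ) : Prop :=
  ∀ p : P, expect μ (fun I => (toggleability p I : ℝ)) = 0

end Toggle

/-- The lattice of order ideals of `P` is toggle CDE (tCDE): the expected down-degree is the same
for all toggle-symmetric probability distributions as for the uniform one. -/
def IsToggleCDE (P : Type*) [PartialOrder P] [Finite P] : Prop :=
  ∀ μ : LowerSet P → ℝ, IsProbDist μ → IsToggleSymmetric μ →
    expect μ (fun I => (ddeg I : ℝ)) = expect (uniform (LowerSet P)) (fun I => (ddeg I : ℝ))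

/-! ### Crystallographic root posets -/

section Crystallographic

variable {ι M N : Type*} [Finite ι] [AddCommGroup M] [Module ℝ M] [AddCommGroup N] [Module ℝ N]
  {Φ : RootPairing ι ℝ M N} [Φ.IsRootSystem] [Φ.IsCrystallographic] [Φ.IsReduced]

/-- The positive roots of `Φ` with respect to a choice `b` of simple roots. -/
def PosRoot (b : Φ.Base) : Type _ := {i : ι // b.IsPos i}

instance (b : Φ.Base) : Finite (PosRoot b) :=
  inferInstanceAs (Finite {i : ι // b.IsPos i})

/-- The root poset: `α ≤ β` if and only if `β - α` is a nonnegative combination of simple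
roots. -/
instance (b : Φ.Base) : PartialOrder (PosRoot b) where
  le α β := ∃ a : b.support → ℝ, (∀ k, 0 ≤ a k) ∧
    Φ.root β.1 - Φ.root α.1 = ∑ k : b.support, a k • Φ.root k
  le_refl α := ⟨0, by simp, by simp⟩
  le_trans α β γ := by
    rintro ⟨a, ha, ha'⟩ ⟨c, hc, hc'⟩
    refine ⟨a + c, fun k => add_nonneg (ha k) (hc k), ?_⟩
    simp only [Pi.add_apply, add_smul, Finset.sum_add_distrib, ← ha', ← hc']
    abel
  le_antisymm α β := by
    rintro ⟨a, ha, ha'⟩ ⟨c, hc, hc'⟩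
    have hli := Fintype.linearIndependent_iff.mp b.linearIndepOn_root (a + c) (by
      simp only [Pi.add_apply, add_smul, Finset.sum_add_distrib]
      exact (congrArg₂ (· + ·) ha' hc').symm.trans (by abel))
    have ha0 : ∀ k, a k = 0 := fun k => by
      have h1 := hli k
      have h2 := ha k
      have h3 := hc k
      simp only [Pi.add_apply] at h1
      linarith
    have : Φ.root β.1 = Φ.root α.1 := by
      rw [← sub_eq_zero, ha']
      simp [ha0]
    exact Subtype.ext (Φ.root.injective this.symm)

/-- The Cartan matrix of `Φ` is `A`, for some labelling of the simple roots. -/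
def HasCartanMatrix (b : Φ.Base) {n : ℕ} (A : Matrix (Fin n) (Fin n) ℤ) : Prop :=
  ∃ e : b.support ≃ Fin n, ∀ i j, b.cartanMatrix i j = A (e i) (e j)

/-- The crystallographic coincidental types `A_n`, `B_n`, `C_n` and `G₂`. -/
def IsCoincidentalType (b : Φ.Base) : Prop :=
  (∃ n, HasCartanMatrix b (CartanMatrix.A n)) ∨
  (∃ n, HasCartanMatrix b (CartanMatrix.B n)) ∨
  (∃ n, HasCartanMatrix b (CartanMatrix.C n)) ∨
  HasCartanMatrix b CartanMatrix.G₂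

end Crystallographic

/-! ### The root posets of types `H₃` and `I₂(m)` -/

/-- The elements of the root poset of type `H₃`. -/
def RootPosetH3 : Type := Fin 15

instance : Fintype RootPosetH3 := inferInstanceAs (Fintype (Fin 15))

/-- The Hasse diagram of the root poset of type `H₃`: `i` is covered by `j`. By rank, the elements
are `0 1 2 | 3 4 | 5 6 | 7 8 | 9 10 | 11 | 12 | 13 | 14`. -/
def coverH3 (i j : Fin 15) : Prop :=
  (i, j) ∈ ([(0, 3), (1, 3), (1, 4), (2, 4), (3, 5), (4, 5), (4, 6), (5, 7), (6, 7), (6, 8),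
    (7, 9), (7, 10), (8, 10), (9, 11), (10, 11), (11, 12), (12, 13), (13, 14)] :
    List (Fin 15 × Fin 15))

theorem lt_of_coverH3 {i j : Fin 15} (h : coverH3 i j) : i < j := by
  unfold coverH3 at h
  revert i j
  decide

theorem le_of_reflTransGen_coverH3 {i j : Fin 15} (h : Relation.ReflTransGen coverH3 i j) :
    i ≤ j := by
  induction h with
  | refl => exact le_refl _
  | tail _ h ih => exact ih.trans (lt_of_coverH3 h).le

/-- The root poset of type `H₃`, generated by its Hasse diagram. -/
instance : PartialOrder RootPosetH3 where
  le i j := Relation.ReflTransGen coverH3 i j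
  le_refl _ := Relation.ReflTransGen.refl
  le_trans _ _ _ := Relation.ReflTransGen.trans
  le_antisymm _ _ h h' :=
    le_antisymm (α := Fin 15) (le_of_reflTransGen_coverH3 h) (le_of_reflTransGen_coverH3 h')

/-- The coefficients of the toggle identity for the root poset of type `H₃`. -/
def coeffH3 : RootPosetH3 → ℤ :=
  ![1, 1, 1, 0, 0, -1, 0, -2, 0, -1, -2, -4, -3, -2, -1]

/-- The elements of the root poset of type `I₂(m)`. -/
def RootPosetI2 (m : ℕ) : Type := Fin m

instance (m : ℕ) : Fintype (RootPosetI2 m) := inferInstanceAs (Fintype (Fin m))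

/-- The root poset of type `I₂(m)`: the elements `0` and `1` are incomparable, and both lie below
the chain `2 < 3 < ⋯ < m - 1`. -/
instance (m : ℕ) : PartialOrder (RootPosetI2 m) where
  le i j := i = j ∨ (Fin.val i < Fin.val j ∧ 2 ≤ Fin.val j)
  le_refl _ := Or.inl rfl
  le_trans i j k := by
    rintro (rfl | ⟨h, h'⟩) (rfl | ⟨g, g'⟩)
    · exact Or.inl rfl
    · exact Or.inr ⟨g, g'⟩
    · exact Or.inr ⟨h, h'⟩
    · exact Or.inr ⟨h.trans g, g'⟩
  le_antisymm i j := by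
    rintro (rfl | ⟨h, h'⟩) (g | ⟨g, g'⟩)
    · rfl
    · rfl
    · exact g.symm
    · exact absurd h (lt_asymm g)

end RootPosetCDE

open RootPosetCDE

/-!
# Root posets of coincidental type are toggle CDE

The engine is `isToggleCDE_of_identity`: if integers `c p` and `K` exist such that
`2 * ddeg + ∑ p, c p * toggleability p = K` as functions on the order ideals, then every
toggle-symmetric distribution has expected down-degree `K / 2`. The uniform distribution is
toggle-symmetric because toggling at `p` is an involution which changes the sign of the
toggleability at `p`. The down-degree of `I` is the number of maximal elements of `I`, and `p` can
be toggled out of (into) `I` exactly when it is maximal in `I` (minimal outside `I`), so such an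
identity is a statement about the boundary of `I`.

* Types `A`, `B`, `C`. The root poset of type `Aₙ` is a staircase of cells `(i, j)` with
  `0 ≤ i < j ≤ n`; those of types `Bₙ` and `Cₙ` are both the half staircase `i < j ≤ 2 * n - 1 - i`.
  An order ideal is recorded by its row lengths `a i`, and row `i` has at most one element that can
  be toggled out, in column `a i`, and at most one that can be toggled in, in column `a i + 1`. With
  coefficients `2 - ht p` (modified on the axis of symmetry of the half staircase) the contributions
  of the rows telescope: see `isToggleCDE_of_isStaircase` and `isToggleCDE_of_isStaircase_half`.
* Types `G₂` and `I₂(m)`. The poset is a chain placed above two minimal elements, and the identity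
  follows by distinguishing whether the ideal reaches the chain: `IsDihedral.identity`.
* Type `H₃`. The poset has 32 order ideals, on which the identity is evaluated: `identity_H3`.

To pass from an abstract root system to these posets, `IsPositiveSystem` gives conditions on a set
`R` of integer vectors, in terms of the Cartan matrix only, under which `R` is the set of coordinate
vectors of the positive roots. The essential ones are that `R` is stable under simple reflections,
except for the simple root being negated, and that every element of `R` pairs positively with some
simple coroot. The root poset is then `R` with the componentwise order
(`HasCartanMatrix.exists_coordinates`).
-/

open RootPosetCDE

namespace RootPosetCDE

/-! ### Toggles and the toggle CDE criterion -/

section Criterion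

variable {P : Type*} [PartialOrder P]

theorem isLowerSet_insert_iff {I : LowerSet P} {p : P} (hp : p ∉ I) :
    IsLowerSet (insert p (I : Set P)) ↔ Minimal (· ∉ I) p := by
  constructor
  · intro h
    refine ⟨hp, fun y hy hyp => ?_⟩
    rcases h hyp (Set.mem_insert p _) with rfl | h'
    · exact le_rfl
    · exact absurd h' hy
  · rintro h x y hyx (rfl | hx)
    · by_cases hy : y ∈ I
      · exact Or.inr hy
      · exact Or.inl (le_antisymm hyx (h.2 hy hyx))
    · exact Or.inr (I.lower hyx hx)

theorem isLowerSet_diff_singleton_iff {I : LowerSet P} {p : P} (hp : p ∈ I) :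
    IsLowerSet ((I : Set P) \ {p}) ↔ Maximal (· ∈ I) p := by
  constructor
  · intro h
    refine ⟨hp, fun y hy hpy => ?_⟩
    by_contra hne
    exact (h hpy ⟨hy, fun h' => hne (h' ▸ le_rfl)⟩).2 rfl
  · rintro h x y hyx ⟨hx, hne⟩
    refine ⟨I.lower hyx hx, ?_⟩
    rintro rfl
    exact hne (le_antisymm (h.2 hx hyx) hyx)

theorem lt_toggle_iff {I : LowerSet P} {p : P} : I < toggle p I ↔ Minimal (· ∉ I) p := by
  unfold toggle
  split_ifs with h h'
  · refine iff_of_true ?_ ((isLowerSet_insert_iff h.1).1 h.2)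
    rw [← LowerSet.coe_ssubset_coe]
    exact Set.ssubset_insert h.1
  · refine iff_of_false (fun hlt => ?_) (fun hm => hm.1 h'.1)
    exact hlt.not_ge fun x hx => hx.1
  · exact iff_of_false (lt_irrefl _) fun hm => h ⟨hm.1, (isLowerSet_insert_iff hm.1).2 hm⟩

theorem toggle_lt_iff {I : LowerSet P} {p : P} : toggle p I < I ↔ Maximal (· ∈ I) p := by
  unfold toggle
  split_ifs with h h'
  · refine iff_of_false (fun hlt => ?_) (fun hm => h.1 hm.1)
    exact hlt.not_ge fun x hx => Or.inr hx
  · refine iff_of_true ?_ ((isLowerSet_diff_singleton_iff h'.1).1 h'.2)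
    rw [← LowerSet.coe_ssubset_coe]
    exact Set.sdiff_singleton_ssubset.2 h'.1
  · exact iff_of_false (lt_irrefl _)
      fun hm => h' ⟨hm.1, (isLowerSet_diff_singleton_iff hm.1).2 hm⟩

open Classical in
theorem toggleIn_eq (p : P) (I : LowerSet P) :
    toggleIn p I = if Minimal (· ∉ I) p then 1 else 0 := by
  simp only [toggleIn, lt_toggle_iff]

open Classical in
theorem toggleOut_eq (p : P) (I : LowerSet P) :
    toggleOut p I = if Maximal (· ∈ I) p then 1 else 0 := by
  simp only [toggleOut, toggle_lt_iff]

theorem toggle_toggle (p : P) (I : LowerSet P) : toggle p (toggle p I) = I := by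
  by_cases h : p ∉ I ∧ IsLowerSet (insert p (I : Set P))
  · have h1 : toggle p I = ⟨insert p (I : Set P), h.2⟩ := by rw [toggle, dif_pos h]
    have h2 : insert p (I : Set P) \ {p} = I := Set.insert_sdiff_self_of_notMem h.1
    have h3 : p ∈ toggle p I := by rw [h1]; exact Set.mem_insert p _
    have h4 : (toggle p I : Set P) \ {p} = I := by rw [h1]; exact h2
    rw [toggle, dif_neg (fun h' => h'.1 h3), dif_pos ⟨h3, by rw [h4]; exact I.lower⟩]
    exact LowerSet.ext h4
  · by_cases h' : p ∈ I ∧ IsLowerSet ((I : Set P) \ {p})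
    · have h1 : toggle p I = ⟨(I : Set P) \ {p}, h'.2⟩ := by rw [toggle, dif_neg h, dif_pos h']
      have h3 : p ∉ toggle p I := by rw [h1]; exact fun hp => hp.2 rfl
      have h4 : insert p (toggle p I : Set P) = I := by
        rw [h1]; exact Set.insert_sdiff_self_of_mem h'.1
      rw [toggle, dif_pos ⟨h3, by rw [h4]; exact I.lower⟩]
      exact LowerSet.ext h4
    · have h1 : toggle p I = I := by rw [toggle, dif_neg h, dif_neg h']
      rw [h1, h1]

/-- Toggling at `p` exchanges being able to toggle `p` in with being able to toggle `p` out. -/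
theorem toggleability_toggle (p : P) (I : LowerSet P) :
    toggleability p (toggle p I) = -toggleability p I := by
  unfold toggleability toggleIn toggleOut
  rw [toggle_toggle, neg_sub]

/-- The order ideals covered by `I` are obtained by removing a maximal element of `I`. -/
theorem ddeg_eq_card_maximal [Finite P] (I : LowerSet P) :
    ddeg I = Nat.card {p : P // Maximal (· ∈ I) p} := by
  have lt (p : P) (hp : Maximal (· ∈ I) p) : toggle p I < I := toggle_lt_iff.2 hp
  have coe (p : P) (hp : Maximal (· ∈ I) p) : (toggle p I : Set P) = (I : Set P) \ {p} := by
    rw [toggle, dif_neg (fun h => h.1 hp.1),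
      dif_pos ⟨hp.1, (isLowerSet_diff_singleton_iff hp.1).2 hp⟩]
    rfl
  symm
  refine Nat.card_congr (Equiv.ofBijective
    (fun p => ⟨toggle p.1 I, lt p.1 p.2, fun {K} h1 h2 => ?_⟩) ⟨?_, ?_⟩)
  · obtain ⟨hle, x, hxK, hx⟩ := Set.ssubset_iff_exists.1 (LowerSet.coe_ssubset_coe.2 h1)
    rw [coe p.1 p.2] at hx hle
    have hxp : x = p.1 := by
      by_contra hne
      exact hx ⟨h2.le hxK, hne⟩
    refine h2.not_ge fun y hy => ?_
    by_cases hyp : y = p.1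
    · rw [hyp, ← hxp]; exact hxK
    · exact hle ⟨hy, hyp⟩
  · rintro ⟨p, hp⟩ ⟨q, hq⟩ h
    have h' : (I : Set P) \ {p} = (I : Set P) \ {q} := by
      rw [← coe p hp, ← coe q hq]
      exact congrArg (fun J : LowerSet P => (J : Set P)) (congrArg Subtype.val h)
    by_contra hne
    have : p ∈ (I : Set P) \ {q} := ⟨hp.1, fun h => hne (Subtype.ext h)⟩
    rw [← h'] at this
    exact this.2 rfl
  · rintro ⟨J, hJ⟩
    obtain ⟨hle, x, hxI, hxJ⟩ := Set.ssubset_iff_exists.1 (LowerSet.coe_ssubset_coe.2 hJ.lt)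
    obtain ⟨p, -, hp⟩ := (Set.toFinite {x | x ∈ I ∧ x ∉ J}).exists_le_maximal
      (show x ∈ {x | x ∈ I ∧ x ∉ J} from ⟨hxI, hxJ⟩)
    have hpm : Maximal (· ∈ I) p :=
      ⟨hp.1.1, fun y hy hpy => hp.2 ⟨hy, fun hyJ => hp.1.2 (J.lower hpy hyJ)⟩ hpy⟩
    refine ⟨⟨p, hpm⟩, Subtype.ext ?_⟩
    have hJp : J ≤ toggle p I := by
      rw [← LowerSet.coe_subset_coe, coe p hpm]
      exact fun y hy => ⟨hle hy, fun h => hp.1.2 ((Set.mem_singleton_iff.1 h) ▸ hy)⟩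
    exact (hJp.eq_or_lt.resolve_right fun h => hJ.2 h (lt p hpm)).symm

theorem ddeg_eq_sum_toggleOut [Fintype P] (I : LowerSet P) :
    (ddeg I : ℤ) = ∑ p : P, toggleOut p I := by
  classical
  simp only [ddeg_eq_card_maximal, toggleOut_eq, Finset.sum_boole, Nat.card_eq_fintype_card,
    Fintype.card_subtype]

theorem isProbDist_uniform (X : Type*) [Finite X] [Nonempty X] : IsProbDist (uniform X) := by
  have := Fintype.ofFinite X
  refine ⟨fun x => by unfold uniform; positivity, ?_⟩
  simp [uniform, finsum_eq_sum_of_fintype]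

theorem isToggleSymmetric_uniform [Finite P] :
    IsToggleSymmetric (uniform (LowerSet P)) := by
  have := Fintype.ofFinite (LowerSet P)
  intro p
  have key : ∑ I : LowerSet P, (toggleability p I : ℝ) = 0 := by
    have h : ∑ I : LowerSet P, (toggleability p (toggle p I) : ℝ) =
        ∑ I : LowerSet P, (toggleability p I : ℝ) :=
      Function.Bijective.sum_comp (Function.Involutive.bijective (toggle_toggle p))
        fun I => (toggleability p I : ℝ)
    simp only [toggleability_toggle, Int.cast_neg, Finset.sum_neg_distrib] at h
    linarith
  simp only [expect, uniform, finsum_eq_sum_of_fintype, ← Finset.mul_sum, key, mul_zero]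

/-- If `2 * ddeg` is constant up to a linear combination of toggleability statistics, then every
toggle-symmetric distribution, in particular the uniform one, has the same expected down-degree. -/
theorem isToggleCDE_of_identity [Fintype P] (c : P → ℤ) (K : ℤ)
    (h : ∀ I : LowerSet P, 2 * (ddeg I : ℤ) + ∑ p : P, c p * toggleability p I = K) :
    IsToggleCDE P := by
  have := Fintype.ofFinite (LowerSet P)
  have key : ∀ μ : LowerSet P → ℝ, IsProbDist μ → IsToggleSymmetric μ →
      expect μ (fun I => (ddeg I : ℝ)) = K / 2 := by
    intro μ hμ hs
    have hs' (p : P) : ∑ I, μ I * (toggleability p I : ℝ) = 0 := by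
      rw [← finsum_eq_sum_of_fintype]; exact hs p
    have h1 : ∑ I, μ I = 1 := by rw [← finsum_eq_sum_of_fintype]; exact hμ.2
    have hd (I : LowerSet P) :
        (ddeg I : ℝ) = K / 2 - ∑ p : P, c p / 2 * (toggleability p I : ℝ) := by
      have h2 := congrArg (Int.cast : ℤ → ℝ) (h I)
      push_cast at h2
      have h3 : ∑ p : P, (c p : ℝ) / 2 * (toggleability p I : ℝ) =
          (∑ p : P, (c p : ℝ) * (toggleability p I : ℝ)) / 2 := by
        rw [Finset.sum_div]
        exact Finset.sum_congr rfl fun p _ => by ring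
      rw [h3]
      linarith
    have h0 : ∑ I, μ I * ∑ p : P, (c p : ℝ) / 2 * (toggleability p I : ℝ) = 0 := by
      simp only [Finset.mul_sum]
      rw [Finset.sum_comm]
      refine Finset.sum_eq_zero fun p _ => ?_
      rw [← mul_zero ((c p : ℝ) / 2), ← hs' p, Finset.mul_sum]
      exact Finset.sum_congr rfl fun I _ => by ring
    simp only [expect, finsum_eq_sum_of_fintype, hd, mul_sub, Finset.sum_sub_distrib, h0,
      ← Finset.sum_mul, h1]
    ring
  intro μ hμ hs
  rw [key μ hμ hs, key _ (isProbDist_uniform _) isToggleSymmetric_uniform]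

end Criterion
/-! ### Staircase posets -/

/-- The coordinates `f` identify `P` with the set of pairs `(i, j)` such that `i < j ≤ U i`, where
`(i, j)` lies below `(i', j')` when `i' ≤ i` and `j ≤ j'`. The function `U` is antitone and the
nonempty rows are those with `i < n`. -/
structure IsStaircase {P : Type*} [PartialOrder P] (n : ℕ) (U : ℕ → ℕ) (f : P → ℕ × ℕ) :
    Prop where
  antitone : Antitone U
  lt_iff : ∀ i, i < U i ↔ i < n
  le_iff : ∀ p q, p ≤ q ↔ (f q).1 ≤ (f p).1 ∧ (f p).2 ≤ (f q).2
  exists_iff : ∀ i j, (∃ p, f p = (i, j)) ↔ i < j ∧ j ≤ U i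

namespace IsStaircase

variable {P : Type*} [PartialOrder P] {n : ℕ} {U : ℕ → ℕ} {f : P → ℕ × ℕ}

theorem injective (hf : IsStaircase n U f) : Function.Injective f := by
  intro p q h
  exact le_antisymm ((hf.le_iff p q).2 (by simp [h])) ((hf.le_iff q p).2 (by simp [h]))

theorem fst_lt_snd (hf : IsStaircase n U f) (p : P) : (f p).1 < (f p).2 :=
  ((hf.exists_iff _ _).1 ⟨p, rfl⟩).1

theorem snd_le (hf : IsStaircase n U f) (p : P) : (f p).2 ≤ U (f p).1 :=
  ((hf.exists_iff _ _).1 ⟨p, rfl⟩).2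

theorem fst_lt (hf : IsStaircase n U f) (p : P) : (f p).1 < n :=
  (hf.lt_iff _).1 ((hf.fst_lt_snd p).trans_le (hf.snd_le p))

theorem sum_eq [Fintype P] (hf : IsStaircase n U f) (g : ℕ → ℕ → ℤ) :
    ∑ p : P, g (f p).1 (f p).2 = ∑ i ∈ Finset.range n, ∑ j ∈ Finset.Ioc i (U i), g i j := by
  rw [Finset.sum_sigma']
  refine Finset.sum_bij (fun p _ => ⟨(f p).1, (f p).2⟩) ?_ ?_ ?_ ?_
  · intro p _
    simp [hf.fst_lt p, hf.fst_lt_snd p, hf.snd_le p]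
  · intro p _ q _ h
    simp only [Sigma.mk.injEq, heq_eq_eq] at h
    exact hf.injective (Prod.ext h.1 h.2)
  · rintro ⟨i, j⟩ h
    simp only [Finset.mem_sigma, Finset.mem_range, Finset.mem_Ioc] at h
    obtain ⟨p, hp⟩ := (hf.exists_iff i j).2 h.2
    exact ⟨p, Finset.mem_univ _, by rw [hp]⟩
  · intro p _
    rfl

/-- The function `a` records the lengths of the rows of the order ideal `I`: row `i` of `I` consists
of the pairs `(i, j)` with `i < j ≤ a i`. -/
structure IsProfile (n : ℕ) (U : ℕ → ℕ) (f : P → ℕ × ℕ) (I : LowerSet P) (a : ℕ → ℕ) : Prop where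
  le : ∀ i < n, i ≤ a i
  le' : ∀ i < n, a i ≤ U i
  mem_iff : ∀ p, p ∈ I ↔ (f p).2 ≤ a (f p).1

theorem exists_isProfile (hf : IsStaircase n U f) (I : LowerSet P) :
    ∃ a, IsProfile n U f I a := by
  classical
  let Q : ℕ → ℕ → Prop := fun i j => j ≤ i ∨ ∃ p ∈ I, f p = (i, j)
  refine ⟨fun i => Nat.findGreatest (Q i) (U i), ⟨fun i hi => ?_, fun i _ => ?_, fun p => ?_⟩⟩
  · exact Nat.le_findGreatest ((hf.lt_iff i).2 hi).le (Or.inl le_rfl)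
  · exact Nat.findGreatest_le _
  · constructor
    · intro hp
      exact Nat.le_findGreatest (hf.snd_le p) (Or.inr ⟨p, hp, rfl⟩)
    · intro h
      have hlt := hf.fst_lt_snd p
      have hspec : Q (f p).1 (Nat.findGreatest (Q (f p).1) (U (f p).1)) :=
        Nat.findGreatest_spec (P := Q (f p).1) (m := (f p).1)
          (hlt.le.trans (hf.snd_le p)) (Or.inl le_rfl)
      rcases hspec with hle | ⟨q, hq, hfq⟩
      · omega
      · refine I.lower ((hf.le_iff p q).2 ?_) hq
        rw [hfq]
        exact ⟨le_rfl, h⟩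

variable {I : LowerSet P} {a : ℕ → ℕ}

/-- Rows of an order ideal grow with `i`, unless the next row of the staircase is too short. -/
theorem IsProfile.le_succ (ha : IsProfile n U f I a) (hf : IsStaircase n U f) {i : ℕ}
    (hi : i + 1 < n) : min (a i) (U (i + 1)) ≤ a (i + 1) := by
  by_contra! h
  have h1 := ha.le (i + 1) hi
  have h2 := hf.antitone (Nat.le_succ i)
  have h3 : a (i + 1) < a i := h.trans_le (min_le_left _ _)
  have h4 : a (i + 1) < U (i + 1) := h.trans_le (min_le_right _ _)
  obtain ⟨p, hp⟩ := (hf.exists_iff (i + 1) (a (i + 1) + 1)).2 ⟨by omega, by omega⟩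
  obtain ⟨q, hq⟩ := (hf.exists_iff i (a (i + 1) + 1)).2 ⟨by omega, h4.trans_le h2⟩
  have hqI : q ∈ I := (ha.mem_iff q).2 (by rw [hq]; exact h3)
  have hpI : p ∈ I := I.lower ((hf.le_iff p q).2 (by simp [hp, hq])) hqI
  have := (ha.mem_iff p).1 hpI
  rw [hp] at this
  simp at this

theorem IsProfile.maximal_iff (ha : IsProfile n U f I a) (hf : IsStaircase n U f) (p : P) :
    Maximal (· ∈ I) p ↔
      (f p).2 = a (f p).1 ∧ ((f p).1 = 0 ∨ a ((f p).1 - 1) < a (f p).1) := by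
  have h1 := hf.fst_lt_snd p
  have h2 := hf.snd_le p
  have h3 := ha.le' _ (hf.fst_lt p)
  constructor
  · rintro ⟨hp, hmax⟩
    have h4 := (ha.mem_iff p).1 hp
    have h5 : (f p).2 = a (f p).1 := by
      by_contra hne
      obtain ⟨q, hq⟩ := (hf.exists_iff (f p).1 ((f p).2 + 1)).2 ⟨by omega, by omega⟩
      have := (hf.le_iff q p).1 (hmax ((ha.mem_iff q).2 (by rw [hq]; dsimp only; omega))
        ((hf.le_iff p q).2 (by simp [hq])))
      rw [hq] at this
      dsimp only at this
      omega
    refine ⟨h5, ?_⟩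
    by_contra! hcon
    have h6 := hf.antitone (Nat.sub_le (f p).1 1)
    obtain ⟨q, hq⟩ := (hf.exists_iff ((f p).1 - 1) (f p).2).2 ⟨by omega, by omega⟩
    have := (hf.le_iff q p).1 (hmax ((ha.mem_iff q).2 (by rw [hq]; dsimp only; omega))
      ((hf.le_iff p q).2 (by simp [hq])))
    rw [hq] at this
    dsimp only at this
    omega
  · rintro ⟨h4, h5⟩
    refine ⟨(ha.mem_iff p).2 h4.le, fun q hq hpq => ?_⟩
    obtain ⟨h6, h7⟩ := (hf.le_iff p q).1 hpq
    have h8 : (f q).1 = (f p).1 := by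
      by_contra hne
      have h9 := hf.antitone (Nat.sub_le (f p).1 1)
      obtain ⟨r, hr⟩ := (hf.exists_iff ((f p).1 - 1) (f p).2).2 ⟨by omega, by omega⟩
      have hrI : r ∈ I := I.lower ((hf.le_iff r q).2 (by rw [hr]; dsimp only; omega)) hq
      have := (ha.mem_iff r).1 hrI
      rw [hr] at this
      dsimp only at this
      omega
    have h9 := (ha.mem_iff q).1 hq
    rw [h8] at h9
    exact (hf.le_iff q p).2 ⟨h8.ge, by omega⟩

theorem IsProfile.minimal_iff (ha : IsProfile n U f I a) (hf : IsStaircase n U f) (p : P) :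
    Minimal (· ∉ I) p ↔ (f p).2 = a (f p).1 + 1 ∧
      ((f p).1 < a (f p).1 → a (f p).1 < U ((f p).1 + 1) → a (f p).1 < a ((f p).1 + 1)) := by
  have h1 := hf.fst_lt_snd p
  have h2 := hf.snd_le p
  have h3 := ha.le _ (hf.fst_lt p)
  constructor
  · rintro ⟨hp, hmin⟩
    have h4 : a (f p).1 < (f p).2 := not_le.1 fun h => hp ((ha.mem_iff p).2 h)
    have h5 : (f p).2 = a (f p).1 + 1 := by
      by_contra hne
      obtain ⟨q, hq⟩ := (hf.exists_iff (f p).1 ((f p).2 - 1)).2 ⟨by omega, by omega⟩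
      have hqI : q ∉ I := fun h => by
        have := (ha.mem_iff q).1 h
        rw [hq] at this
        dsimp only at this
        omega
      have := (hf.le_iff p q).1 (hmin hqI ((hf.le_iff q p).2 (by simp [hq])))
      rw [hq] at this
      dsimp only at this
      omega
    refine ⟨h5, fun h6 h7 => ?_⟩
    by_contra hcon
    obtain ⟨q, hq⟩ := (hf.exists_iff ((f p).1 + 1) (f p).2).2 ⟨by omega, by omega⟩
    have hqI : q ∉ I := fun h => by
      have := (ha.mem_iff q).1 h
      rw [hq] at this
      dsimp only at this
      omega
    have := (hf.le_iff p q).1 (hmin hqI ((hf.le_iff q p).2 (by simp [hq])))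
    rw [hq] at this
    dsimp only at this
    omega
  · rintro ⟨h4, h5⟩
    refine ⟨fun h => ?_, fun q hq hqp => ?_⟩
    · have := (ha.mem_iff p).1 h
      omega
    · obtain ⟨h6, h7⟩ := (hf.le_iff q p).1 hqp
      have h8 := hf.fst_lt_snd q
      have h9 := hf.snd_le q
      have h10 : (f q).1 = (f p).1 := by
        by_contra hne
        have h11 : U (f q).1 ≤ U ((f p).1 + 1) := hf.antitone (by omega)
        obtain ⟨r, hr⟩ := (hf.exists_iff ((f p).1 + 1) (f q).2).2 ⟨by omega, by omega⟩
        refine hq (I.lower ((hf.le_iff q r).2 (by rw [hr]; dsimp only; omega))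
          ((ha.mem_iff r).2 ?_))
        rw [hr]
        dsimp only
        by_cases h12 : (f p).2 ≤ U ((f p).1 + 1)
        · have := h5 (by omega) (by omega)
          omega
        · have := ha.le_succ hf (i := (f p).1) ((hf.lt_iff _).1 (by omega))
          omega
      have h11 : ¬ (f q).2 ≤ a (f q).1 := fun h => hq ((ha.mem_iff q).2 h)
      rw [h10] at h11
      exact (hf.le_iff p q).2 ⟨h10.le, by omega⟩

/-- Each row of an order ideal contains at most one element that can be toggled out and at most one
that can be toggled in. -/
theorem IsProfile.identity_eq_sum [Fintype P] (ha : IsProfile n U f I a) (hf : IsStaircase n U f)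
    (c : ℕ → ℕ → ℤ) :
    2 * (ddeg I : ℤ) + ∑ p : P, c (f p).1 (f p).2 * toggleability p I =
      ∑ i ∈ Finset.range n,
        ((if i < a i ∧ (i = 0 ∨ a (i - 1) < a i) then 2 - c i (a i) else 0) +
        (if a i < U i ∧ (i < a i → a i < U (i + 1) → a i < a (i + 1)) then c i (a i + 1)
          else 0)) := by
  classical
  let g : ℕ → ℕ → ℤ := fun i j =>
    (if j = a i then (if i = 0 ∨ a (i - 1) < a i then 2 - c i j else 0) else 0) +
    (if j = a i + 1 then
      (if i < a i → a i < U (i + 1) → a i < a (i + 1) then c i j else 0) else 0)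
  have h1 : 2 * (ddeg I : ℤ) + ∑ p : P, c (f p).1 (f p).2 * toggleability p I =
      ∑ p : P, g (f p).1 (f p).2 := by
    rw [ddeg_eq_sum_toggleOut, Finset.mul_sum, ← Finset.sum_add_distrib]
    refine Finset.sum_congr rfl fun p _ => ?_
    simp only [toggleability, toggleIn_eq, toggleOut_eq, ha.maximal_iff hf, ha.minimal_iff hf,
      ite_and, g]
    split_ifs <;> ring
  rw [h1, hf.sum_eq]
  simp only [g]
  refine Finset.sum_congr rfl fun i hi => ?_
  have h2 := ha.le i (Finset.mem_range.1 hi)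
  have h3 := ha.le' i (Finset.mem_range.1 hi)
  rw [Finset.sum_add_distrib, Finset.sum_ite_eq', Finset.sum_ite_eq']
  simp only [Finset.mem_Ioc, h3, and_true, ite_and, Nat.lt_succ_iff, h2, true_and,
    Nat.succ_le_iff]

end IsStaircase

/-- In the full staircase the toggle identity holds with the coefficients `2 - ht p`, where
`ht (i, j) = j - i`. Row by row, the sum telescopes. -/
theorem isToggleCDE_of_isStaircase {P : Type*} [PartialOrder P] [Finite P] {n : ℕ}
    {f : P → ℕ × ℕ} (hf : IsStaircase n (fun _ => n) f) : IsToggleCDE P := by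
  have := Fintype.ofFinite P
  refine isToggleCDE_of_identity (fun p => 2 - ((f p).2 - (f p).1 : ℤ)) n fun I => ?_
  obtain ⟨a, ha⟩ := hf.exists_isProfile I
  rw [ha.identity_eq_sum hf fun i j => 2 - ((j : ℤ) - i)]
  -- The first `r + 1` rows contribute the end of row `r`, and the element of row `r` that can be
  -- toggled in.
  have key : ∀ r, r + 1 ≤ n → ∑ i ∈ Finset.range (r + 1),
        ((if i < a i ∧ (i = 0 ∨ a (i - 1) < a i) then 2 - (2 - ((a i : ℤ) - i)) else 0) +
        (if a i < n ∧ (i < a i → a i < n → a i < a (i + 1)) then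
          2 - (((a i + 1 : ℕ) : ℤ) - i) else 0)) =
      a r + if a r < n ∧ (r < a r → a r < n → a r < a (r + 1)) then
          2 - (((a r + 1 : ℕ) : ℤ) - r) else 0 := by
    intro r
    induction r with
    | zero =>
      intro _
      rw [Finset.sum_range_one]
      congr 1
      split_ifs <;> simp_all
    | succ r ih =>
      intro hr
      have h0 : a r ≤ n := ha.le' r (by omega)
      have h1 : min (a r) n ≤ a (r + 1) := ha.le_succ hf hr
      have h2 : a (r + 1) ≤ n := ha.le' (r + 1) hr
      have h3 := ha.le (r + 1) hr
      rw [Finset.sum_range_succ, ih (by omega), ← add_assoc]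
      congr 1
      rw [Nat.add_sub_cancel]
      clear ih
      split_ifs <;> lia
  cases n with
  | zero => simp
  | succ m =>
    rw [key m le_rfl]
    have h1 := ha.le m (by omega)
    have h2 : a m ≤ m + 1 := ha.le' m (by omega)
    split_ifs <;> lia

/-- In the half staircase the toggle identity holds with the coefficients `2 - ht p` off the axis
`i + j = 2 * n - 1`, and `(3 - ht p) / 2 = 2 - n + i` on it. This is the identity of the full
staircase of size `2 * n - 1`, folded along its axis of symmetry. -/
theorem isToggleCDE_of_isStaircase_half {P : Type*} [PartialOrder P] [Finite P] {n : ℕ}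
    {f : P → ℕ × ℕ} (hf : IsStaircase n (fun i => 2 * n - 1 - i) f) : IsToggleCDE P := by
  have := Fintype.ofFinite P
  let c : ℕ → ℕ → ℤ := fun i j => if i + j + 1 = 2 * n then 2 - n + i else 2 - ((j : ℤ) - i)
  refine isToggleCDE_of_identity (fun p => c (f p).1 (f p).2) n fun I => ?_
  obtain ⟨a, ha⟩ := hf.exists_isProfile I
  rw [ha.identity_eq_sum hf c]
  -- The first `r + 1` rows contribute the end of row `r` (or `n`, if the row ends on the axis), and
  -- the element of row `r` that can be toggled in.
  have key : ∀ r, r + 1 ≤ n → ∑ i ∈ Finset.range (r + 1),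
        ((if i < a i ∧ (i = 0 ∨ a (i - 1) < a i) then 2 - c i (a i) else 0) +
        (if a i < 2 * n - 1 - i ∧ (i < a i → a i < 2 * n - 1 - (i + 1) → a i < a (i + 1)) then
          c i (a i + 1) else 0)) =
      (if r + a r + 1 = 2 * n then (n : ℤ) else a r) +
        if a r < 2 * n - 1 - r ∧ (r < a r → a r < 2 * n - 1 - (r + 1) → a r < a (r + 1)) then
          c r (a r + 1) else 0 := by
    intro r
    induction r with
    | zero =>
      intro _
      rw [Finset.sum_range_one]
      congr 1
      simp only [c]
      split_ifs <;> simp_all <;> omega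
    | succ r ih =>
      intro hr
      have h0 : a r ≤ 2 * n - 1 - r := ha.le' r (by omega)
      have h1 : min (a r) (2 * n - 1 - (r + 1)) ≤ a (r + 1) := ha.le_succ hf hr
      have h2 : a (r + 1) ≤ 2 * n - 1 - (r + 1) := ha.le' (r + 1) hr
      have h3 := ha.le (r + 1) hr
      have h4 := ha.le r (by omega)
      rw [Finset.sum_range_succ, ih (by omega), ← add_assoc]
      congr 1
      rw [Nat.add_sub_cancel]
      clear ih
      simp only [c]
      split_ifs <;> lia
  cases n with
  | zero => simp
  | succ m =>
    rw [key m le_rfl]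
    have h1 := ha.le m (by omega)
    have h2 : a m ≤ 2 * (m + 1) - 1 - m := ha.le' m (by omega)
    simp only [c]
    split_ifs <;> lia

/-! ### Dihedral root posets -/

/-- A poset consisting of two minimal elements `a`, `b` and a chain above both of them, such as a
root poset of type `I₂(m)` or `G₂`. -/
structure IsDihedral {P : Type*} [PartialOrder P] (a b : P) : Prop where
  ne : a ≠ b
  isMin_left : IsMin a
  isMin_right : IsMin b
  lt : ∀ x, x ≠ a → x ≠ b → a < x ∧ b < x
  total : ∀ x y, x ≠ a → x ≠ b → y ≠ a → y ≠ b → x ≤ y ∨ y ≤ x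

namespace IsDihedral

variable {P : Type*} [PartialOrder P] {a b : P}

theorem symm (h : IsDihedral a b) : IsDihedral b a where
  ne := h.ne.symm
  isMin_left := h.isMin_right
  isMin_right := h.isMin_left
  lt x hb ha := (h.lt x ha hb).symm
  total x y hxb hxa hyb hya := h.total x y hxa hxb hya hyb

theorem toggleOut_add_toggleIn (h : IsDihedral a b) {I : LowerSet P}
    (hI : ∀ x ∈ I, x = a ∨ x = b) : toggleOut a I + toggleIn a I = 1 := by
  classical
  rw [toggleOut_eq, toggleIn_eq]
  by_cases ha : a ∈ I
  · have hm : Maximal (· ∈ I) a := by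
      refine ⟨ha, fun y hy hay => ?_⟩
      rcases hI y hy with rfl | rfl
      · exact le_rfl
      · exact h.isMin_right hay
    rw [if_pos hm, if_neg fun hm => hm.1 ha, add_zero]
  · rw [if_neg fun hm => ha hm.1, if_pos ⟨ha, fun y _ hya => h.isMin_left hya⟩, zero_add]

theorem toggleability_eq_zero (h : IsDihedral a b) {I : LowerSet P} {x : P} (hx : x ∈ I)
    (hxa : x ≠ a) (hxb : x ≠ b) : toggleability a I = 0 := by
  classical
  have hlt := (h.lt x hxa hxb).1
  rw [toggleability, toggleOut_eq, toggleIn_eq, if_neg fun hm => hm.1 (I.lower hlt.le hx),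
    if_neg fun hm => hlt.not_ge (hm.2 hx hlt.le), sub_zero]

theorem identity [Fintype P] (h : IsDihedral a b) (I : LowerSet P) :
    2 * (ddeg I : ℤ) + toggleability a I + toggleability b I = 2 := by
  classical
  by_cases hI : ∀ x ∈ I, x = a ∨ x = b
  · have h1 : (ddeg I : ℤ) = toggleOut a I + toggleOut b I := by
      rw [ddeg_eq_sum_toggleOut, ← Finset.sum_pair (f := fun p => toggleOut p I) h.ne]
      refine (Finset.sum_subset (Finset.subset_univ _) fun x _ hx => ?_).symm
      rw [toggleOut_eq, if_neg fun hm => hx (by simpa using hI x hm.1)]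
    have h2 := h.toggleOut_add_toggleIn hI
    have h3 := h.symm.toggleOut_add_toggleIn fun x hx => (hI x hx).symm
    rw [h1, toggleability, toggleability]
    linarith
  · push Not at hI
    -- An ideal that reaches the chain has a unique maximal element, and `a` and `b` do not toggle.
    obtain ⟨x, hx, hxa, hxb⟩ := hI
    rw [h.toggleability_eq_zero hx hxa hxb, h.symm.toggleability_eq_zero hx hxb hxa]
    obtain ⟨m, hxm, hm⟩ := (Set.toFinite (I : Set P)).exists_le_maximal hx
    have hne {y : P} (hxy : x ≤ y) : y ≠ a ∧ y ≠ b :=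
      ⟨fun e => hxa (h.isMin_left.eq_of_le (e ▸ hxy)),
        fun e => hxb (h.isMin_right.eq_of_le (e ▸ hxy))⟩
    have h1 : ddeg I = 1 := by
      rw [ddeg_eq_card_maximal, Nat.card_eq_one_iff_exists]
      refine ⟨⟨m, hm⟩, fun ⟨q, hq⟩ => Subtype.ext ?_⟩
      obtain ⟨hma, hmb⟩ := hne hxm
      have hlt := h.lt m hma hmb
      by_cases hqa : q = a
      · exact absurd (hq.2 hm.1 (hqa ▸ hlt.1.le)) (hqa ▸ hlt.1.not_ge)
      by_cases hqb : q = b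
      · exact absurd (hq.2 hm.1 (hqb ▸ hlt.2.le)) (hqb ▸ hlt.2.not_ge)
      rcases h.total q m hqa hqb hma hmb with hle | hle
      · exact le_antisymm hle (hq.2 hm.1 hle)
      · exact le_antisymm (hm.2 hq.1 hle) hle
    rw [h1]
    norm_num

theorem isToggleCDE [Finite P] (h : IsDihedral a b) : IsToggleCDE P := by
  classical
  have := Fintype.ofFinite P
  refine isToggleCDE_of_identity (fun p => if p = a ∨ p = b then 1 else 0) 2 fun I => ?_
  refine Eq.trans ?_ (h.identity I)
  rw [add_assoc, ← Finset.sum_pair (f := fun p => toggleability p I) h.ne]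
  refine congrArg (2 * (ddeg I : ℤ) + ·) ?_
  rw [← Finset.sum_subset (Finset.subset_univ {a, b}) fun x _ hx => ?_]
  · refine Finset.sum_congr rfl fun x hx => ?_
    rw [if_pos (by simpa using hx), one_mul]
  · rw [if_neg (by simpa using hx), zero_mul]

end IsDihedral

theorem RootPosetI2.le_iff {m : ℕ} (i j : RootPosetI2 m) :
    i ≤ j ↔ i = j ∨ (Fin.val i < Fin.val j ∧ 2 ≤ Fin.val j) := Iff.rfl

theorem RootPosetI2.isMin_iff {m : ℕ} (hm : 2 ≤ m) (i : RootPosetI2 m) :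
    IsMin i ↔ Fin.val i < 2 := by
  constructor
  · intro h
    by_contra! h2
    let z : RootPosetI2 m := (⟨0, by omega⟩ : Fin m)
    have hz : Fin.val z = 0 := rfl
    rcases (RootPosetI2.le_iff i z).1 (h ((RootPosetI2.le_iff z i).2 (Or.inr (by omega)))) with
      h3 | h3
    · have := congrArg Fin.val h3
      omega
    · omega
  · intro h j hj
    rcases (RootPosetI2.le_iff j i).1 hj with rfl | h'
    · exact le_rfl
    · omega

theorem RootPosetI2.isDihedral {m : ℕ} (hm : 2 ≤ m) {a b : RootPosetI2 m} (hab : a ≠ b)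
    (ha : IsMin a) (hb : IsMin b) : IsDihedral a b := by
  have ha' := (RootPosetI2.isMin_iff hm a).1 ha
  have hb' := (RootPosetI2.isMin_iff hm b).1 hb
  have hab' : Fin.val a ≠ Fin.val b := fun h => hab (Fin.ext h)
  have key (x : RootPosetI2 m) (hxa : x ≠ a) (hxb : x ≠ b) : 2 ≤ Fin.val x := by
    have h1 : Fin.val x ≠ Fin.val a := fun h => hxa (Fin.ext h)
    have h2 : Fin.val x ≠ Fin.val b := fun h => hxb (Fin.ext h)
    omega
  refine ⟨hab, ha, hb, fun x hxa hxb => ?_, fun x y hxa hxb hya hyb => ?_⟩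
  · have := key x hxa hxb
    exact ⟨lt_of_le_of_ne ((RootPosetI2.le_iff _ _).2 (Or.inr (by omega))) hxa.symm,
      lt_of_le_of_ne ((RootPosetI2.le_iff _ _).2 (Or.inr (by omega))) hxb.symm⟩
  · have h1 := key x hxa hxb
    have h2 := key y hya hyb
    rcases lt_trichotomy (Fin.val x) (Fin.val y) with h | h | h
    · exact Or.inl ((RootPosetI2.le_iff _ _).2 (Or.inr ⟨h, h2⟩))
    · exact Or.inl ((RootPosetI2.le_iff _ _).2 (Or.inl (Fin.ext h)))
    · exact Or.inr ((RootPosetI2.le_iff _ _).2 (Or.inr ⟨h, h1⟩))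

theorem isToggleCDE_rootPosetI2 {m : ℕ} (hm : 2 ≤ m) : IsToggleCDE (RootPosetI2 m) := by
  let a : RootPosetI2 m := (⟨0, by omega⟩ : Fin m)
  let b : RootPosetI2 m := (⟨1, by omega⟩ : Fin m)
  have ha : Fin.val a = 0 := rfl
  have hb : Fin.val b = 1 := rfl
  refine (RootPosetI2.isDihedral hm (a := a) (b := b) (fun h => ?_) ?_ ?_).isToggleCDE
  · have := congrArg Fin.val h
    omega
  · exact (RootPosetI2.isMin_iff hm a).2 (by omega)
  · exact (RootPosetI2.isMin_iff hm b).2 (by omega)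

/-! ### The root poset of type `H₃` -/

theorem le_of_coverH3 {i j : RootPosetH3} (h : coverH3 i j) : i ≤ j :=
  Relation.ReflTransGen.single h

theorem ne_of_coverH3 {i j : RootPosetH3} (h : coverH3 i j) : i ≠ j :=
  (lt_of_coverH3 h).ne

theorem maximal_iff_forall_coverH3 {I : LowerSet RootPosetH3} {p : RootPosetH3} :
    Maximal (· ∈ I) p ↔ p ∈ I ∧ ∀ q, coverH3 p q → q ∉ I := by
  constructor
  · rintro ⟨hp, hmax⟩
    exact ⟨hp, fun q h hq => ne_of_coverH3 h
      (le_antisymm (le_of_coverH3 h) (hmax hq (le_of_coverH3 h)))⟩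
  · rintro ⟨hp, h⟩
    refine ⟨hp, fun q hq hpq => ?_⟩
    rcases Relation.ReflTransGen.cases_head hpq with rfl | ⟨r, hpr, hrq⟩
    · exact le_rfl
    · exact absurd (I.lower (a := q) (b := r) hrq hq) (h r hpr)

theorem minimal_iff_forall_coverH3 {I : LowerSet RootPosetH3} {p : RootPosetH3} :
    Minimal (· ∉ I) p ↔ p ∉ I ∧ ∀ q, coverH3 q p → q ∈ I := by
  constructor
  · rintro ⟨hp, hmin⟩
    refine ⟨hp, fun q h => ?_⟩
    by_contra hq
    exact ne_of_coverH3 h (le_antisymm (le_of_coverH3 h) (hmin hq (le_of_coverH3 h)))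
  · rintro ⟨hp, h⟩
    refine ⟨hp, fun q hq hqp => ?_⟩
    rcases Relation.ReflTransGen.cases_tail hqp with rfl | ⟨r, hqr, hrp⟩
    · exact le_rfl
    · exact absurd (I.lower (a := r) (b := q) hqr (h r hrp)) hq

set_option synthInstance.maxHeartbeats 400000 in
set_option synthInstance.maxSize 10000 in
theorem identity_H3 (I : LowerSet RootPosetH3) :
    2 * (ddeg I : ℤ) + ∑ p : RootPosetH3, coeffH3 p * toggleability p I = 3 := by
  obtain ⟨χ, hχ⟩ : ∃ χ : Fin 15 → Bool, ∀ p : RootPosetH3, p ∈ I ↔ χ p = true := by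
    classical exact ⟨fun p => decide ((show RootPosetH3 from p) ∈ I), fun p => by simp⟩
  have mono (i j : Fin 15) (h : coverH3 i j) (hj : χ j = true) : χ i = true :=
    (hχ i).1 (I.lower (le_of_coverH3 (i := i) (j := j) h) ((hχ j).2 hj))
  have : DecidableRel coverH3 := fun i j => inferInstanceAs (Decidable (_ ∈ (_ : List _)))
  have hout (i : Fin 15) : toggleOut (P := RootPosetH3) i I =
      if χ i = true ∧ ∀ j, coverH3 i j → χ j = false then 1 else 0 := by
    classical refine (toggleOut_eq (P := RootPosetH3) i I).trans (if_congr ?_ rfl rfl)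
    exact maximal_iff_forall_coverH3.trans (and_congr (hχ i) (forall_congr' fun q =>
      imp_congr_right fun _ => (not_congr (hχ q)).trans (Bool.not_eq_true _).to_iff))
  have hin (i : Fin 15) : toggleIn (P := RootPosetH3) i I =
      if χ i = false ∧ ∀ j, coverH3 j i → χ j = true then 1 else 0 := by
    classical refine (toggleIn_eq (P := RootPosetH3) i I).trans (if_congr ?_ rfl rfl)
    exact minimal_iff_forall_coverH3.trans
      (and_congr ((not_congr (hχ i)).trans (Bool.not_eq_true _).to_iff)
        (forall_congr' fun q => imp_congr_right fun _ => hχ q))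
  have key : 2 * (ddeg I : ℤ) + ∑ p : RootPosetH3, coeffH3 p * toggleability p I =
      ∑ i : Fin 15, ((if χ i = true ∧ ∀ j, coverH3 i j → χ j = false then 2 - coeffH3 i else 0) +
        (if χ i = false ∧ ∀ j, coverH3 j i → χ j = true then coeffH3 i else 0)) := by
    rw [ddeg_eq_sum_toggleOut, Finset.mul_sum, ← Finset.sum_add_distrib]
    refine Finset.sum_congr rfl fun p _ => ?_
    refine (congrArg₂ (fun x y : ℤ => 2 * x + coeffH3 p * (y - x)) (hout p) (hin p)).trans ?_
    split_ifs <;> ring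
  rw [key]
  simp [Fin.sum_univ_succ, coverH3, coeffH3]
  have h3 : χ 3 → χ 0 ∧ χ 1 := fun h =>
    ⟨mono 0 3 (by simp [coverH3]) h, mono 1 3 (by simp [coverH3]) h⟩
  have h4 : χ 4 → χ 1 ∧ χ 2 := fun h =>
    ⟨mono 1 4 (by simp [coverH3]) h, mono 2 4 (by simp [coverH3]) h⟩
  have h5 : χ 5 → χ 3 ∧ χ 4 := fun h =>
    ⟨mono 3 5 (by simp [coverH3]) h, mono 4 5 (by simp [coverH3]) h⟩
  have h6 : χ 6 → χ 4 := mono 4 6 (by simp [coverH3])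
  have h7 : χ 7 → χ 5 ∧ χ 6 := fun h =>
    ⟨mono 5 7 (by simp [coverH3]) h, mono 6 7 (by simp [coverH3]) h⟩
  have h8 : χ 8 → χ 6 := mono 6 8 (by simp [coverH3])
  have h9 : χ 9 → χ 7 := mono 7 9 (by simp [coverH3])
  have h10 : χ 10 → χ 7 ∧ χ 8 := fun h =>
    ⟨mono 7 10 (by simp [coverH3]) h, mono 8 10 (by simp [coverH3]) h⟩
  have h11 : χ 11 → χ 9 ∧ χ 10 := fun h =>
    ⟨mono 9 11 (by simp [coverH3]) h, mono 10 11 (by simp [coverH3]) h⟩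
  have h12 : χ 12 → χ 11 := mono 11 12 (by simp [coverH3])
  have h13 : χ 13 → χ 12 := mono 12 13 (by simp [coverH3])
  have h14 : χ 14 → χ 13 := mono 13 14 (by simp [coverH3])
  -- Each Boolean is quantified together with its order relations, so that evaluation only visits
  -- the order ideals and not all subsets.
  clear key hin hout mono hχ this
  generalize χ 0 = b0, χ 1 = b1, χ 2 = b2, χ 3 = b3, χ 4 = b4, χ 5 = b5, χ 6 = b6, χ 7 = b7,
    χ 8 = b8, χ 9 = b9, χ 10 = b10, χ 11 = b11, χ 12 = b12, χ 13 = b13, χ 14 = b14 at *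
  clear χ
  revert b14; revert b13; revert b12; revert b11; revert b10; revert b9; revert b8; revert b7
  revert b6; revert b5; revert b4; revert b3
  revert b2 b1 b0
  decide

/-! ### Positive roots from the Cartan matrix -/

section PositiveRoots

/-- The simple reflection `s k` in the coordinates given by the simple roots, for the Cartan
matrix `A`. -/
def simpleReflection {n : ℕ} (A : Matrix (Fin n) (Fin n) ℤ) (k : Fin n) (v : Fin n → ℤ) :
    Fin n → ℤ :=
  v - Pi.single k (∑ l, v l * A l k)

theorem sum_simpleReflection {n : ℕ} (A : Matrix (Fin n) (Fin n) ℤ) (k : Fin n) (v : Fin n → ℤ) :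
    ∑ l, simpleReflection A k v l = ∑ l, v l - ∑ l, v l * A l k := by
  simp [simpleReflection, Finset.sum_sub_distrib, Pi.single_apply]

/-- Combinatorial conditions on a set `R` of coordinate vectors which force it to be the set of
coordinate vectors of the positive roots, for any root system with Cartan matrix `A`. -/
structure IsPositiveSystem {n : ℕ} (A : Matrix (Fin n) (Fin n) ℤ) (R : Set (Fin n → ℤ)) :
    Prop where
  single_mem : ∀ k, Pi.single k 1 ∈ R
  nonneg : ∀ v ∈ R, 0 ≤ v
  reflection_mem : ∀ v ∈ R, ∀ k, v = Pi.single k 1 ∨ simpleReflection A k v ∈ R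
  exists_pos : ∀ v ∈ R, ∃ k, 0 < ∑ l, v l * A l k

variable {ι M N : Type*} [AddCommGroup M] [Module ℝ M] [AddCommGroup N] [Module ℝ N]
  {Φ : RootPairing ι ℝ M N} {b : Φ.Base} {n : ℕ}

/-- The integral combination of the simple roots with coefficients `v`, for the labelling `e` of
the simple roots. -/
noncomputable def combo (b : Φ.Base) (e : b.support ≃ Fin n) (v : Fin n → ℤ) : M :=
  ∑ k : b.support, (v (e k) : ℝ) • Φ.root k

variable (e : b.support ≃ Fin n)

theorem combo_neg (v : Fin n → ℤ) : combo b e (-v) = -combo b e v := by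
  simp [combo]

theorem combo_sub_single (v : Fin n → ℤ) (k : b.support) (z : ℤ) :
    combo b e (v - Pi.single (e k) z) = combo b e v - (z : ℝ) • Φ.root k := by
  classical
  simp [combo, sub_smul, Finset.sum_sub_distrib, Pi.single_apply]

theorem combo_single (k : b.support) : combo b e (Pi.single (e k) 1) = Φ.root k := by
  classical
  simp [combo, Pi.single_apply]

theorem combo_eq_sum (v : Fin n → ℤ) :
    ∃ f : ι → ℤ, combo b e v = ∑ j ∈ b.support, f j • Φ.root j ∧
      ∑ j ∈ b.support, f j = ∑ k, v k := by
  classical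
  refine ⟨fun j => if h : j ∈ b.support then v (e ⟨j, h⟩) else 0, ?_, ?_⟩
  · rw [← Finset.sum_coe_sort b.support]
    refine Finset.sum_congr rfl fun k _ => ?_
    simp only [Finset.coe_mem, dif_pos, Int.cast_smul_eq_zsmul]
  · rw [← Finset.sum_coe_sort b.support, ← e.sum_comp]
    refine Finset.sum_congr rfl fun k _ => ?_
    simp only [Finset.coe_mem, dif_pos]

theorem height_eq_of_root_eq_combo {i : ι} {v : Fin n → ℤ} (h : Φ.root i = combo b e v) :
    b.height i = ∑ k, v k := by
  obtain ⟨f, hf, hf'⟩ := combo_eq_sum (b := b) e v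
  rw [RootPairing.Base.height_eq_sum (h.trans hf), hf']

variable {e} [Φ.IsCrystallographic] {A : Matrix (Fin n) (Fin n) ℤ}
  (he : ∀ i j, b.cartanMatrix i j = A (e i) (e j))

include he

theorem reflection_combo (v : Fin n → ℤ) (k : b.support) :
    Φ.reflection k (combo b e v) = combo b e (simpleReflection A (e k) v) := by
  have h (l : b.support) : Φ.reflection k ((v (e l) : ℝ) • Φ.root l) =
      (v (e l) : ℝ) • Φ.root l - ((v (e l) * A (e l) (e k) : ℤ) : ℝ) • Φ.root k := by
    have h1 : Φ.pairing l k = (A (e l) (e k) : ℝ) := by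
      rw [← he l k, ← RootPairing.Base.algebraMap_cartanMatrixIn_apply ℤ b]
      rfl
    rw [map_smul, RootPairing.reflection_apply_root, h1, smul_sub, smul_smul]
    push_cast
    rfl
  rw [simpleReflection, combo_sub_single, combo, map_sum, Finset.sum_congr rfl fun l _ => h l,
    Finset.sum_sub_distrib, ← Finset.sum_smul, ← e.sum_comp]
  push_cast
  rfl

theorem diag_eq_two (k : Fin n) : A k k = 2 := by
  have := he (e.symm k) (e.symm k)
  rw [RootPairing.Base.cartanMatrix_apply_same, Equiv.apply_symm_apply] at this
  exact this.symm

theorem simpleReflection_single (k : Fin n) :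
    simpleReflection A k (Pi.single k 1) = -Pi.single k 1 := by
  have h : ∑ l, (Pi.single k 1 : Fin n → ℤ) l * A l k = 2 := by
    simp [Pi.single_apply, diag_eq_two he]
  rw [simpleReflection, h, ← Pi.single_sub, ← Pi.single_neg]
  norm_num

theorem simpleReflection_simpleReflection (k : Fin n) (v : Fin n → ℤ) :
    simpleReflection A k (simpleReflection A k v) = v := by
  set z := ∑ l, v l * A l k with hz
  have h : ∑ l, simpleReflection A k v l * A l k = -z := by
    simp only [simpleReflection, Pi.sub_apply, sub_mul, Finset.sum_sub_distrib, ← hz]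
    simp [Pi.single_apply, diag_eq_two he]
    ring
  rw [simpleReflection, h, simpleReflection, Pi.single_neg]
  abel

variable {R : Set (Fin n → ℤ)}

/-- Every positive root has its coordinates in `R`, because `R ∪ -R` contains the simple roots and
is stable under the simple reflections. -/
theorem IsPositiveSystem.exists_root_eq [Finite ι] [Φ.IsReduced] (hR : IsPositiveSystem A R)
    {i : ι} (hi : b.IsPos i) : ∃ v ∈ R, Φ.root i = combo b e v := by
  obtain ⟨v, hv, h | h⟩ : ∃ v ∈ R, Φ.root i = combo b e v ∨ Φ.root i = combo b e (-v) := by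
    refine hi.induction_on_reflect
      (p := fun i => ∃ v ∈ R, Φ.root i = combo b e v ∨ Φ.root i = combo b e (-v)) ?_ ?_
    · exact fun i hi => ⟨_, hR.single_mem (e ⟨i, hi⟩), Or.inl (combo_single e ⟨i, hi⟩).symm⟩
    · rintro i j ⟨v, hv, h⟩ hj
      rw [RootPairing.root_reflectionPerm]
      rcases hR.reflection_mem v hv (e ⟨j, hj⟩) with h' | h'
      · refine ⟨v, hv, ?_⟩
        have h1 := reflection_combo he v ⟨j, hj⟩
        rw [h', simpleReflection_single he, ← h'] at h1
        rcases h with h | h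
        · exact Or.inr (by rw [h, h1])
        · exact Or.inl (by rw [h, combo_neg, map_neg, h1, combo_neg, neg_neg])
      · refine ⟨_, h', ?_⟩
        have h1 := reflection_combo he v ⟨j, hj⟩
        rcases h with h | h
        · exact Or.inl (by rw [h, h1])
        · exact Or.inr (by rw [h, combo_neg, map_neg, h1, combo_neg])
  · exact ⟨v, hv, h⟩
  · have h1 : b.height i = -∑ k, v k := by simpa using height_eq_of_root_eq_combo e h
    have h2 : 0 ≤ ∑ k, v k := Finset.sum_nonneg fun k _ => hR.nonneg v hv k
    have h3 := b.isPos_iff.1 hi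
    omega

/-- Every element of `R` is the coordinate vector of a positive root: a suitable simple reflection
either lowers its height within `R` or shows that it is simple. -/
theorem IsPositiveSystem.exists_isPos (hR : IsPositiveSystem A R) {v : Fin n → ℤ} (hv : v ∈ R) :
    ∃ i, b.IsPos i ∧ Φ.root i = combo b e v := by
  suffices h : ∃ i, Φ.root i = combo b e v by
    obtain ⟨i, hi⟩ := h
    refine ⟨i, b.isPos_iff'.2 ?_, hi⟩
    rw [height_eq_of_root_eq_combo e hi]
    exact Finset.sum_nonneg fun k _ => hR.nonneg v hv k
  induction hN : (∑ l, v l).toNat using Nat.strongRecOn generalizing v with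
  | ind N ih =>
    obtain ⟨k, hk⟩ := hR.exists_pos v hv
    obtain ⟨k, rfl⟩ := e.surjective k
    rcases hR.reflection_mem v hv (e k) with rfl | hmem
    · exact ⟨k, (combo_single e k).symm⟩
    · have h1 := sum_simpleReflection A (e k) v
      have h2 : 0 ≤ ∑ l, simpleReflection A (e k) v l :=
        Finset.sum_nonneg fun l _ => hR.nonneg _ hmem l
      obtain ⟨i, hi⟩ := ih _ (by omega) hmem rfl
      refine ⟨Φ.reflectionPerm k i, ?_⟩
      rw [RootPairing.root_reflectionPerm, hi, reflection_combo he,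
        simpleReflection_simpleReflection he]

end PositiveRoots

section RootPoset

variable {ι M N : Type*} [AddCommGroup M] [Module ℝ M] [AddCommGroup N] [Module ℝ N]
  {Φ : RootPairing ι ℝ M N} {b : Φ.Base} {n : ℕ}

theorem PosRoot.le_iff {e : b.support ≃ Fin n} {α β : PosRoot b} {v w : Fin n → ℤ}
    (hv : Φ.root α.1 = combo b e v) (hw : Φ.root β.1 = combo b e w) : α ≤ β ↔ v ≤ w := by
  have key : Φ.root β.1 - Φ.root α.1 =
      ∑ k : b.support, ((w (e k) - v (e k) : ℤ) : ℝ) • Φ.root k := by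
    simp [hv, hw, combo, sub_smul, Finset.sum_sub_distrib]
  constructor
  · rintro ⟨a, ha, h⟩ k
    have h1 := Fintype.linearIndependent_iffₛ.mp b.linearIndepOn_root _ _ (key.symm.trans h)
      (e.symm k)
    have h2 := ha (e.symm k)
    rw [← h1, Equiv.apply_symm_apply] at h2
    have h3 : 0 ≤ w k - v k := by exact_mod_cast h2
    exact sub_nonneg.1 h3
  · intro h
    exact ⟨_, fun k => by exact_mod_cast sub_nonneg.2 (h (e k)), key⟩

variable [Finite ι] [Φ.IsCrystallographic] [Φ.IsReduced]

/-- The root poset is determined by the coordinate vectors of the positive roots, ordered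
componentwise. -/
theorem HasCartanMatrix.exists_coordinates {A : Matrix (Fin n) (Fin n) ℤ}
    (hA : HasCartanMatrix b A) {R : Set (Fin n → ℤ)} (hR : IsPositiveSystem A R) :
    ∃ g : PosRoot b → Fin n → ℤ, Set.range g = R ∧ ∀ α β, α ≤ β ↔ g α ≤ g β := by
  obtain ⟨e, he⟩ := hA
  choose g hgR hg using fun α : PosRoot b => hR.exists_root_eq he α.2
  have hle (α β : PosRoot b) : α ≤ β ↔ g α ≤ g β := PosRoot.le_iff (hg α) (hg β)
  refine ⟨g, Set.Subset.antisymm (Set.range_subset_iff.2 hgR) fun v hv => ?_, hle⟩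
  obtain ⟨i, hi, h⟩ := hR.exists_isPos he hv
  let α : PosRoot b := ⟨i, hi⟩
  have h1 := PosRoot.le_iff (α := α) (β := α) (hg α) h
  have h2 := PosRoot.le_iff (α := α) (β := α) h (hg α)
  exact ⟨α, le_antisymm (h1.1 le_rfl) (h2.1 le_rfl)⟩

end RootPoset
/-! ### Staircases from Cartan matrices -/

section Types

variable {n : ℕ}

/-- If the positive roots have coordinate vectors `F i j`, indexed by the cells `(i, j)` of a
staircase in an order-preserving way, then the root poset is that staircase. -/
theorem HasCartanMatrix.exists_isStaircase {ι M N : Type*} [Finite ι] [AddCommGroup M] [Module ℝ M]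
    [AddCommGroup N] [Module ℝ N] {Φ : RootPairing ι ℝ M N} [Φ.IsCrystallographic] [Φ.IsReduced]
    {b : Φ.Base} {A : Matrix (Fin n) (Fin n) ℤ} (hA : HasCartanMatrix b A) {U : ℕ → ℕ}
    {F : ℕ → ℕ → Fin n → ℤ} (hR : IsPositiveSystem A {v | ∃ i j, i < j ∧ j ≤ U i ∧ v = F i j})
    (hU : Antitone U) (hU' : ∀ i, i < U i ↔ i < n)
    (hF : ∀ i j i' j', i < j → j ≤ U i → i' < j' → j' ≤ U i' →
      (F i j ≤ F i' j' ↔ i' ≤ i ∧ j ≤ j')) :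
    ∃ f : PosRoot b → ℕ × ℕ, IsStaircase n U f := by
  obtain ⟨g, hg, hle⟩ := hA.exists_coordinates hR
  have hmem (α : PosRoot b) : ∃ p : ℕ × ℕ, p.1 < p.2 ∧ p.2 ≤ U p.1 ∧ g α = F p.1 p.2 := by
    obtain ⟨i, j, h⟩ : g α ∈ {v | ∃ i j, i < j ∧ j ≤ U i ∧ v = F i j} := hg ▸ ⟨α, rfl⟩
    exact ⟨(i, j), h⟩
  choose f hf1 hf2 hf using hmem
  refine ⟨f, hU, hU', fun α β => ?_, fun i j => ⟨?_, fun ⟨h1, h2⟩ => ?_⟩⟩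
  · rw [hle, hf, hf, hF _ _ _ _ (hf1 α) (hf2 α) (hf1 β) (hf2 β)]
  · rintro ⟨α, hα⟩
    have h1 := hf1 α
    have h2 := hf2 α
    rw [hα] at h1 h2
    exact ⟨h1, h2⟩
  · obtain ⟨α, hα⟩ : F i j ∈ Set.range g := hg ▸ ⟨i, j, h1, h2, rfl⟩
    have h3 := (hF _ _ _ _ h1 h2 (hf1 α) (hf2 α)).1 (by rw [← hα, hf])
    have h4 := (hF _ _ _ _ (hf1 α) (hf2 α) h1 h2).1 (by rw [← hα, hf])
    exact ⟨α, Prod.ext (le_antisymm h3.1 h4.1) (le_antisymm h4.2 h3.2)⟩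

/-- The pairing of a coordinate vector `G` with a column `A` of a tridiagonal matrix. -/
theorem sum_mul_tridiagonal (G : ℕ → ℤ) (k : Fin n) (p q : ℤ) (A : Fin n → ℤ)
    (hA : ∀ l : Fin n, A l = if l = k then 2 else if l.1 + 1 = k.1 then p else
      if k.1 + 1 = l.1 then q else 0) :
    ∑ l : Fin n, G l * A l =
      2 * G k + (if 0 < k.1 then p * G (k - 1) else 0) +
        if k.1 + 1 < n then q * G (k + 1) else 0 := by
  let H : ℕ → ℤ := fun l => (if l = k.1 then 2 * G k else 0) +
    (if l = k.1 - 1 then (if 0 < k.1 then p * G (k - 1) else 0) else 0) +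
    (if l = k.1 + 1 then q * G (k + 1) else 0)
  have h1 (l : Fin n) : G l * A l = H l := by
    rw [hA]
    have hk : l = k ↔ l.1 = k.1 := Fin.ext_iff
    simp only [hk, H]
    rcases Nat.lt_trichotomy l.1 k.1 with h | h | h
    · by_cases h' : l.1 + 1 = k.1
      · have h2 : l.1 = k.1 - 1 := by omega
        rw [if_neg (by omega), if_pos h', if_neg (by omega), if_pos h2, if_pos (by omega),
          if_neg (by omega), h2]
        ring
      · rw [if_neg (by omega), if_neg h', if_neg (by omega), if_neg (by omega), if_neg (by omega),
          if_neg (by omega)]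
        ring
    · rw [if_pos h, if_pos h, if_neg (by omega : ¬ l.1 = k.1 + 1), h]
      by_cases h0 : 0 < k.1
      · rw [if_neg (by omega)]; ring
      · simp [h0]; ring
    · by_cases h' : k.1 + 1 = l.1
      · rw [if_neg (by omega), if_neg (by omega), if_pos h', if_neg (by omega), if_neg (by omega),
          if_pos h'.symm, h']
        ring
      · rw [if_neg (by omega), if_neg (by omega), if_neg h', if_neg (by omega), if_neg (by omega),
          if_neg (by omega)]
        ring
  have hk := k.2
  rw [Finset.sum_congr rfl fun l _ => h1 l, Fin.sum_univ_eq_sum_range H n]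
  simp only [H, Finset.sum_add_distrib, Finset.sum_ite_eq', Finset.mem_range]
  rw [if_pos hk, if_pos (by omega)]

theorem simpleReflection_eq {A : Matrix (Fin n) (Fin n) ℤ} {k : Fin n} {v w : Fin n → ℤ} {c : ℤ}
    (hc : ∑ l, v l * A l k = c) (h : ∀ l : Fin n, v l - (if l.1 = k.1 then c else 0) = w l) :
    simpleReflection A k v = w := by
  funext l
  rw [simpleReflection, hc, Pi.sub_apply, Pi.single_apply, ← h]
  simp only [Fin.ext_iff]

/-! ### Type `A` -/

/-- The coordinates of the root `εᵢ - εⱼ`: the simple roots from `i` to `j - 1`, each once. -/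
def vectorA (n i j : ℕ) (k : Fin n) : ℤ :=
  if i ≤ k.1 ∧ k.1 < j then 1 else 0

theorem sum_vectorA_mul {i j : ℕ} (hij : i < j) (hj : j ≤ n) (k : Fin n) :
    ∑ l, vectorA n i j l * CartanMatrix.A n l k =
      (if k.1 = i then 1 else 0) + (if k.1 + 1 = j then 1 else 0) -
        (if k.1 + 1 = i then 1 else 0) - (if k.1 = j then 1 else 0) := by
  have hk := k.2
  rw [show ∑ l, vectorA n i j l * CartanMatrix.A n l k = _ from
    sum_mul_tridiagonal (fun l => if i ≤ l ∧ l < j then 1 else 0) k (-1) (-1)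
      (fun l => CartanMatrix.A n l k) fun l => by
        simp only [CartanMatrix.A, Matrix.of_apply]
        split_ifs <;> first | rfl | omega]
  split_ifs <;> omega

theorem isPositiveSystem_A (n : ℕ) :
    IsPositiveSystem (CartanMatrix.A n) {v | ∃ i j, i < j ∧ j ≤ n ∧ v = vectorA n i j} where
  single_mem k := by
    refine ⟨k, k + 1, by omega, k.2, funext fun l => ?_⟩
    simp only [vectorA, Pi.single_apply, Fin.ext_iff]
    split_ifs <;> omega
  nonneg := by
    rintro _ ⟨i, j, -, -, rfl⟩ k
    simp only [vectorA, Pi.zero_apply]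
    split_ifs <;> omega
  reflection_mem := by
    rintro _ ⟨i, j, hij, hj, rfl⟩ k
    have hk := k.2
    by_cases hs : k.1 = i ∧ k.1 + 1 = j
    · left
      funext l
      simp only [vectorA, Pi.single_apply, Fin.ext_iff]
      split_ifs <;> omega
    right
    have main (i' j' : ℕ) (hij' : i' < j') (hj' : j' ≤ n)
        (h : ∀ l : Fin n, vectorA n i j l - (if l.1 = k.1 then _ else 0) = vectorA n i' j' l) :
        simpleReflection (CartanMatrix.A n) k (vectorA n i j) ∈
          {v | ∃ i j, i < j ∧ j ≤ n ∧ v = vectorA n i j} :=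
      ⟨i', j', hij', hj', simpleReflection_eq (sum_vectorA_mul hij hj k) h⟩
    simp only [vectorA] at main
    -- The reflection exchanges `ε k` and `ε (k + 1)`.
    by_cases h1 : k.1 = i
    · refine main (k + 1) j (by omega) hj fun l => ?_
      split_ifs <;> omega
    by_cases h2 : k.1 + 1 = i
    · refine main k j (by omega) hj fun l => ?_
      split_ifs <;> omega
    by_cases h3 : k.1 = j
    · refine main i (k + 1) (by omega) hk fun l => ?_
      split_ifs <;> omega
    by_cases h4 : k.1 + 1 = j
    · refine main i k (by omega) hk.le fun l => ?_
      split_ifs <;> omega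
    · refine main i j hij hj fun l => ?_
      split_ifs <;> omega
  exists_pos := by
    rintro _ ⟨i, j, hij, hj, rfl⟩
    refine ⟨⟨i, by omega⟩, ?_⟩
    rw [sum_vectorA_mul hij hj]
    dsimp only
    split_ifs <;> omega

theorem vectorA_le_iff {i j i' j' : ℕ} (hij : i < j) (hj : j ≤ n) :
    vectorA n i j ≤ vectorA n i' j' ↔ i' ≤ i ∧ j ≤ j' := by
  constructor
  · intro h
    have h1 := h ⟨i, by omega⟩
    have h2 := h ⟨j - 1, by omega⟩
    simp only [vectorA] at h1 h2
    constructor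
    · split_ifs at h1 <;> omega
    · split_ifs at h2 <;> omega
  · intro h k
    simp only [vectorA]
    split_ifs <;> omega

/-! ### Type `B` -/

/-- The coordinates of the short root `εᵢ` (for `j = n`) and of the long roots `εᵢ - εⱼ` (for
`j < n`) and `εᵢ + ε₂ₙ₋ⱼ` (for `n < j`). They are obtained by folding those of type `A` in rank
`2 * n` along the symmetry `k ↦ 2 * n - 1 - k` of the Dynkin diagram. -/
def vectorB (n i j : ℕ) (k : Fin n) : ℤ :=
  (if i ≤ k.1 ∧ k.1 < j then 1 else 0) + if 2 * n ≤ k.1 + j then 1 else 0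

/-- The coefficient of `εₘ` in the root with coordinates `vectorB n i j`. -/
def epsilonB (n i j m : ℕ) : ℤ :=
  (if m = i then 1 else 0) - (if m = j then 1 else 0) + if m + j = 2 * n then 1 else 0

theorem sum_vectorB_mul {i j : ℕ} (hij : i < j) (hj : j ≤ 2 * n - 1 - i) (k : Fin n) :
    ∑ l, vectorB n i j l * CartanMatrix.B n l k =
      if k.1 + 1 < n then epsilonB n i j k - epsilonB n i j (k + 1) else 2 * epsilonB n i j k := by
  have hk := k.2
  -- `P` and `Q` are the two intervals whose indicators add up to the coordinates of the root.
  obtain ⟨P, hP⟩ : ∃ P : ℕ → ℤ, ∀ l, P l = if i ≤ l ∧ l < j then 1 else 0 := ⟨_, fun _ => rfl⟩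
  obtain ⟨Q, hQ⟩ : ∃ Q : ℕ → ℤ, ∀ l, Q l = if 2 * n ≤ l + j then 1 else 0 :=
    ⟨_, fun _ => rfl⟩
  have hv (l : Fin n) : vectorB n i j l = P l + Q l := by rw [hP, hQ]; rfl
  have hP1 : P k - (if 0 < k.1 then P (k - 1) else 0) =
      (if k.1 = i then 1 else 0) - if k.1 = j then 1 else 0 := by
    simp only [hP]
    split_ifs <;> omega
  have hP2 : P k - P (k + 1) =
      (if k.1 + 1 = j then 1 else 0) - if k.1 + 1 = i then 1 else 0 := by
    simp only [hP]
    split_ifs <;> omega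
  have hQ1 : Q k - (if 0 < k.1 then Q (k - 1) else 0) = if k.1 + j = 2 * n then 1 else 0 := by
    simp only [hQ]
    split_ifs <;> omega
  have hQ2 : Q k - Q (k + 1) = -if k.1 + 1 + j = 2 * n then 1 else 0 := by
    simp only [hQ]
    split_ifs <;> omega
  have hsum := sum_mul_tridiagonal (fun l => P l + Q l) k (if k.1 + 1 < n then -1 else -2) (-1)
      (fun l => CartanMatrix.B n l k) fun l => by
    simp only [CartanMatrix.B, Matrix.of_apply]
    split_ifs <;> first | rfl | omega
  simp only [hv, hsum, epsilonB]
  generalize (if k.1 = i then (1 : ℤ) else 0) = x1 at *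
  generalize (if k.1 = j then (1 : ℤ) else 0) = x2 at *
  generalize (if k.1 + 1 = i then (1 : ℤ) else 0) = x3 at *
  generalize (if k.1 + 1 = j then (1 : ℤ) else 0) = x4 at *
  generalize (if k.1 + j = 2 * n then (1 : ℤ) else 0) = x5 at *
  generalize (if k.1 + 1 + j = 2 * n then (1 : ℤ) else 0) = x6 at *
  split_ifs at hP1 hQ1 ⊢ <;> linarith

theorem isPositiveSystem_B (n : ℕ) : IsPositiveSystem (CartanMatrix.B n)
    {v | ∃ i j, i < j ∧ j ≤ 2 * n - 1 - i ∧ v = vectorB n i j} where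
  single_mem k := by
    have hk := k.2
    refine ⟨k, k + 1, by omega, by omega, funext fun l => ?_⟩
    simp only [vectorB, Pi.single_apply, Fin.ext_iff]
    split_ifs <;> omega
  nonneg := by
    rintro _ ⟨i, j, -, -, rfl⟩ k
    simp only [vectorB, Pi.zero_apply]
    split_ifs <;> omega
  reflection_mem := by
    rintro _ ⟨i, j, hij, hj, rfl⟩ k
    have hk := k.2
    by_cases hs : k.1 = i ∧ k.1 + 1 = j
    · left
      funext l
      simp only [vectorB, Pi.single_apply, Fin.ext_iff]
      split_ifs <;> omega
    right
    have main (i' j' : ℕ) (hij' : i' < j') (hj' : j' ≤ 2 * n - 1 - i')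
        (c : ℤ)
        (hc : (if k.1 + 1 < n then epsilonB n i j k - epsilonB n i j (k + 1) else
          2 * epsilonB n i j k) = c)
        (h : ∀ l : Fin n, vectorB n i j l - (if l.1 = k.1 then c else 0) = vectorB n i' j' l) :
        simpleReflection (CartanMatrix.B n) k (vectorB n i j) ∈
          {v | ∃ i j, i < j ∧ j ≤ 2 * n - 1 - i ∧ v = vectorB n i j} :=
      ⟨i', j', hij', hj', simpleReflection_eq ((sum_vectorB_mul hij hj k).trans hc) h⟩
    simp only [vectorB, epsilonB] at main
    by_cases hkn : k.1 + 1 < n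
    · simp only [hkn, if_true] at main
      -- The reflection exchanges `ε k` and `ε (k + 1)`.
      by_cases h1 : k.1 = i
      · by_cases h2 : k.1 + 1 + j = 2 * n
        · refine main i j hij hj 0 ?_ fun l => ?_ <;>
            split_ifs <;> omega
        · refine main (k + 1) j (by omega) (by omega) 1 ?_ fun l => ?_ <;>
            split_ifs <;> omega
      by_cases h2 : k.1 + 1 = i
      · refine main k j (by omega) (by omega) (-1) ?_ fun l => ?_ <;>
          split_ifs <;> omega
      by_cases h3 : k.1 = j
      · refine main i (k + 1) (by omega) (by omega) (-1) ?_ fun l => ?_ <;>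
          split_ifs <;> omega
      by_cases h4 : k.1 + 1 = j
      · refine main i k (by omega) (by omega) 1 ?_ fun l => ?_ <;>
          split_ifs <;> omega
      by_cases h5 : k.1 + j = 2 * n
      · refine main i (j - 1) (by omega) (by omega) 1 ?_ fun l => ?_ <;>
          split_ifs <;> omega
      by_cases h6 : k.1 + 1 + j = 2 * n
      · refine main i (j + 1) (by omega) (by omega) (-1) ?_ fun l => ?_ <;>
          split_ifs <;> omega
      · refine main i j hij hj 0 ?_ fun l => ?_ <;>
          split_ifs <;> omega
    · simp only [hkn, if_false] at main
      -- The reflection changes the sign of `ε k`.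
      by_cases h1 : k.1 = j
      · refine main i (j + 2) (by omega) (by omega) (-2) ?_ fun l => ?_ <;>
          split_ifs <;> omega
      by_cases h2 : k.1 + j = 2 * n
      · refine main i (j - 2) (by omega) (by omega) 2 ?_ fun l => ?_ <;>
          split_ifs <;> omega
      · refine main i j hij hj 0 ?_ fun l => ?_ <;>
          split_ifs <;> omega
  exists_pos := by
    rintro _ ⟨i, j, hij, hj, rfl⟩
    -- The coroot of the simple root `i` works, except for `εᵢ + εᵢ₊₁`, with which it pairs to zero.
    by_cases h : i + 1 + j = 2 * n ∧ i + 1 < n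
    · refine ⟨⟨i + 1, by omega⟩, ?_⟩
      rw [sum_vectorB_mul hij hj]
      simp only [epsilonB]
      split_ifs <;> omega
    · refine ⟨⟨i, by omega⟩, ?_⟩
      rw [sum_vectorB_mul hij hj]
      simp only [epsilonB]
      split_ifs <;> omega

theorem vectorB_le_iff {i j i' j' : ℕ} (hij : i < j) (hj : j ≤ 2 * n - 1 - i)
    (hj' : j' ≤ 2 * n - 1 - i') :
    vectorB n i j ≤ vectorB n i' j' ↔ i' ≤ i ∧ j ≤ j' := by
  constructor
  · intro h
    have h1 := h ⟨i, by omega⟩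
    -- The only coordinate that changes when `j` is decreased by one.
    have h2 := h ⟨if j ≤ n then j - 1 else 2 * n - j, by split_ifs <;> omega⟩
    simp only [vectorB] at h1 h2
    constructor
    · split_ifs at h1 <;> omega
    · split_ifs at h2 <;> omega
  · intro h k
    simp only [vectorB]
    split_ifs <;> omega

/-! ### Type `C` -/

/-- The coordinates of the long root `2 εᵢ` (for `i + j = 2 * n - 1`) and of the short roots
`εᵢ - εⱼ` (for `j < n`) and `εᵢ + ε₂ₙ₋₁₋ⱼ` (for `n ≤ j`). They are obtained by folding those of
type `A` in rank `2 * n - 1` along the symmetry `k ↦ 2 * n - 2 - k` of the Dynkin diagram, which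
fixes `n - 1`. -/
def vectorC (n i j : ℕ) (k : Fin n) : ℤ :=
  (if i ≤ k.1 ∧ k.1 < j then 1 else 0) + if k.1 + 1 < n ∧ 2 * n ≤ k.1 + j + 1 then 1 else 0

/-- The coefficient of `εₘ` in the root with coordinates `vectorC n i j`. -/
def epsilonC (n i j m : ℕ) : ℤ :=
  (if m = i then 1 else 0) - (if m = j then 1 else 0) + if m + j + 1 = 2 * n then 1 else 0

theorem sum_vectorC_mul {i j : ℕ} (hij : i < j) (hj : j ≤ 2 * n - 1 - i) (k : Fin n) :
    ∑ l, vectorC n i j l * CartanMatrix.C n l k =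
      if k.1 + 1 < n then epsilonC n i j k - epsilonC n i j (k + 1) else epsilonC n i j k := by
  have hk := k.2
  -- `P` and `Q` are the two intervals whose indicators add up to the coordinates of the root.
  obtain ⟨P, hP⟩ : ∃ P : ℕ → ℤ, ∀ l, P l = if i ≤ l ∧ l < j then 1 else 0 := ⟨_, fun _ => rfl⟩
  obtain ⟨Q, hQ⟩ : ∃ Q : ℕ → ℤ, ∀ l, Q l = if l + 1 < n ∧ 2 * n ≤ l + j + 1 then 1 else 0 :=
    ⟨_, fun _ => rfl⟩
  have hv (l : Fin n) : vectorC n i j l = P l + Q l := by rw [hP, hQ]; rfl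
  have hP1 : P k - (if 0 < k.1 then P (k - 1) else 0) =
      (if k.1 = i then 1 else 0) - if k.1 = j then 1 else 0 := by
    simp only [hP]
    split_ifs <;> omega
  have hP2 : P k - P (k + 1) =
      (if k.1 + 1 = j then 1 else 0) - if k.1 + 1 = i then 1 else 0 := by
    simp only [hP]
    split_ifs <;> omega
  have hQ1 : k.1 + 1 < n →
      Q k - (if 0 < k.1 then Q (k - 1) else 0) = if k.1 + j + 1 = 2 * n then 1 else 0 := by
    intro h
    simp only [hQ]
    split_ifs <;> omega
  have hQ2 : k.1 + 2 < n → Q k - Q (k + 1) = -if k.1 + 1 + j + 1 = 2 * n then 1 else 0 := by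
    intro h
    simp only [hQ]
    split_ifs <;> omega
  have hQ3 : k.1 + 2 = n →
      Q (k + 1) = 0 ∧ Q k - P (k + 1) = -if k.1 + 1 + j + 1 = 2 * n then 1 else 0 := by
    intro h
    simp only [hP, hQ]
    split_ifs <;> omega
  have hQ4 : k.1 + 1 = n → Q k = 0 ∧
      P k - (if 0 < k.1 then Q (k - 1) else 0) = if k.1 + j + 1 = 2 * n then 1 else 0 := by
    intro h
    simp only [hP, hQ]
    split_ifs <;> omega
  have hsum := sum_mul_tridiagonal (fun l => P l + Q l) k (-1) (if k.1 + 2 < n then -1 else -2)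
      (fun l => CartanMatrix.C n l k) fun l => by
    simp only [CartanMatrix.C, Matrix.of_apply]
    split_ifs <;> first | rfl | omega
  simp only [hv, hsum, epsilonC]
  generalize (if k.1 = i then (1 : ℤ) else 0) = x1 at *
  generalize (if k.1 = j then (1 : ℤ) else 0) = x2 at *
  generalize (if k.1 + 1 = i then (1 : ℤ) else 0) = x3 at *
  generalize (if k.1 + 1 = j then (1 : ℤ) else 0) = x4 at *
  generalize (if k.1 + j + 1 = 2 * n then (1 : ℤ) else 0) = x5 at *
  generalize (if k.1 + 1 + j + 1 = 2 * n then (1 : ℤ) else 0) = x6 at *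
  rcases (by omega : k.1 + 2 < n ∨ k.1 + 2 = n ∨ k.1 + 1 = n) with h | h | h
  · specialize hQ1 (by omega)
    specialize hQ2 h
    simp only [if_pos h, if_pos (by omega : k.1 + 1 < n)]
    split_ifs at hP1 hQ1 ⊢ <;> linarith
  · specialize hQ1 (by omega)
    obtain ⟨h3, h4⟩ := hQ3 h
    simp only [if_neg (by omega : ¬ k.1 + 2 < n), if_pos (by omega : k.1 + 1 < n)]
    split_ifs at hP1 hQ1 ⊢ <;> linarith
  · obtain ⟨h3, h4⟩ := hQ4 h
    simp only [if_neg (by omega : ¬ k.1 + 1 < n)]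
    split_ifs at hP1 h4 ⊢ <;> linarith

theorem isPositiveSystem_C (n : ℕ) : IsPositiveSystem (CartanMatrix.C n)
    {v | ∃ i j, i < j ∧ j ≤ 2 * n - 1 - i ∧ v = vectorC n i j} where
  single_mem k := by
    have hk := k.2
    refine ⟨k, k + 1, by omega, by omega, funext fun l => ?_⟩
    simp only [vectorC, Pi.single_apply, Fin.ext_iff]
    split_ifs <;> omega
  nonneg := by
    rintro _ ⟨i, j, -, -, rfl⟩ k
    simp only [vectorC, Pi.zero_apply]
    split_ifs <;> omega
  reflection_mem := by
    rintro _ ⟨i, j, hij, hj, rfl⟩ k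
    have hk := k.2
    by_cases hs : k.1 = i ∧ k.1 + 1 = j
    · left
      funext l
      simp only [vectorC, Pi.single_apply, Fin.ext_iff]
      split_ifs <;> omega
    right
    have main (i' j' : ℕ) (hij' : i' < j') (hj' : j' ≤ 2 * n - 1 - i')
        (c : ℤ)
        (hc : (if k.1 + 1 < n then epsilonC n i j k - epsilonC n i j (k + 1) else
          epsilonC n i j k) = c)
        (h : ∀ l : Fin n, vectorC n i j l - (if l.1 = k.1 then c else 0) = vectorC n i' j' l) :
        simpleReflection (CartanMatrix.C n) k (vectorC n i j) ∈
          {v | ∃ i j, i < j ∧ j ≤ 2 * n - 1 - i ∧ v = vectorC n i j} :=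
      ⟨i', j', hij', hj', simpleReflection_eq ((sum_vectorC_mul hij hj k).trans hc) h⟩
    simp only [vectorC, epsilonC] at main
    by_cases hkn : k.1 + 1 < n
    · simp only [hkn, if_true] at main
      -- The reflection exchanges `ε k` and `ε (k + 1)`.
      by_cases h1 : k.1 = i
      · by_cases h2 : k.1 + j + 1 = 2 * n
        · refine main (k + 1) (j - 1) (by omega) (by omega) 2 ?_ fun l => ?_ <;>
            split_ifs <;> omega
        by_cases h3 : k.1 + j + 2 = 2 * n
        · refine main i j hij hj 0 ?_ fun l => ?_ <;>
            split_ifs <;> omega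
        · refine main (k + 1) j (by omega) (by omega) 1 ?_ fun l => ?_ <;>
            split_ifs <;> omega
      by_cases h2 : k.1 + 1 = i
      · by_cases h3 : k.1 + j + 2 = 2 * n
        · refine main k (j + 1) (by omega) (by omega) (-2) ?_ fun l => ?_ <;>
            split_ifs <;> omega
        · refine main k j (by omega) (by omega) (-1) ?_ fun l => ?_ <;>
            split_ifs <;> omega
      by_cases h3 : k.1 = j
      · refine main i (k + 1) (by omega) (by omega) (-1) ?_ fun l => ?_ <;>
          split_ifs <;> omega
      by_cases h4 : k.1 + 1 = j
      · refine main i k (by omega) (by omega) 1 ?_ fun l => ?_ <;>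
          split_ifs <;> omega
      by_cases h5 : k.1 + j + 1 = 2 * n
      · refine main i (j - 1) (by omega) (by omega) 1 ?_ fun l => ?_ <;>
          split_ifs <;> omega
      by_cases h6 : k.1 + j + 2 = 2 * n
      · refine main i (j + 1) (by omega) (by omega) (-1) ?_ fun l => ?_ <;>
          split_ifs <;> omega
      · refine main i j hij hj 0 ?_ fun l => ?_ <;>
          split_ifs <;> omega
    · simp only [hkn, if_false] at main
      -- The reflection changes the sign of `ε k`.
      by_cases h1 : k.1 = j
      · refine main i (j + 1) (by omega) (by omega) (-1) ?_ fun l => ?_ <;>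
          split_ifs <;> omega
      by_cases h2 : k.1 + j + 1 = 2 * n
      · refine main i (j - 1) (by omega) (by omega) 1 ?_ fun l => ?_ <;>
          split_ifs <;> omega
      · refine main i j hij hj 0 ?_ fun l => ?_ <;>
          split_ifs <;> omega
  exists_pos := by
    rintro _ ⟨i, j, hij, hj, rfl⟩
    -- The coroot of the simple root `i` works, except for `εᵢ + εᵢ₊₁`, with which it pairs to zero.
    by_cases h : i + j + 2 = 2 * n
    · refine ⟨⟨i + 1, by omega⟩, ?_⟩
      rw [sum_vectorC_mul hij hj]
      simp only [epsilonC]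
      split_ifs <;> omega
    · refine ⟨⟨i, by omega⟩, ?_⟩
      rw [sum_vectorC_mul hij hj]
      simp only [epsilonC]
      split_ifs <;> omega

theorem vectorC_le_iff {i j i' j' : ℕ} (hij : i < j) (hj : j ≤ 2 * n - 1 - i)
    (hj' : j' ≤ 2 * n - 1 - i') :
    vectorC n i j ≤ vectorC n i' j' ↔ i' ≤ i ∧ j ≤ j' := by
  constructor
  · intro h
    have h1 := h ⟨i, by omega⟩
    -- The only coordinate that changes when `j` is decreased by one.
    have h2 := h ⟨if j ≤ n then j - 1 else 2 * n - 1 - j, by split_ifs <;> omega⟩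
    simp only [vectorC] at h1 h2
    constructor
    · split_ifs at h1 <;> omega
    · split_ifs at h2 <;> omega
  · intro h k
    simp only [vectorC]
    split_ifs <;> omega

end Types
/-! ### Type `G₂` -/

/-- The coordinates of the positive roots of type `G₂`. -/
def vectorsG2 : Set (Fin 2 → ℤ) :=
  {![1, 0], ![0, 1], ![1, 1], ![1, 2], ![1, 3], ![2, 3]}

theorem isPositiveSystem_G2 : IsPositiveSystem CartanMatrix.G₂ vectorsG2 where
  single_mem k := by
    fin_cases k
    · exact Or.inl (by decide)
    · exact Or.inr (Or.inl (by decide))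
  nonneg := by
    rintro v (rfl | rfl | rfl | rfl | rfl | rfl) k <;> revert k <;> decide
  reflection_mem := by
    simp only [vectorsG2, Set.mem_insert_iff, Set.mem_singleton_iff, simpleReflection]
    rintro v (rfl | rfl | rfl | rfl | rfl | rfl) k <;> revert k <;> decide
  exists_pos := by
    rintro v (rfl | rfl | rfl | rfl | rfl | rfl) <;> decide

section

variable {ι M N : Type*} [Finite ι] [AddCommGroup M] [Module ℝ M] [AddCommGroup N] [Module ℝ N]
  {Φ : RootPairing ι ℝ M N} [Φ.IsCrystallographic] [Φ.IsReduced] {b : Φ.Base}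

theorem HasCartanMatrix.exists_isDihedral (hA : HasCartanMatrix b CartanMatrix.G₂) :
    ∃ α β : PosRoot b, IsDihedral α β := by
  obtain ⟨g, hg, hle⟩ := hA.exists_coordinates isPositiveSystem_G2
  have hmem (γ : PosRoot b) : g γ ∈ vectorsG2 := hg ▸ ⟨γ, rfl⟩
  have hinj {γ δ : PosRoot b} (h : g γ = g δ) : γ = δ :=
    le_antisymm ((hle _ _).2 h.le) ((hle _ _).2 h.ge)
  obtain ⟨α, hα⟩ : ![1, 0] ∈ Set.range g := hg ▸ Or.inl rfl
  obtain ⟨β, hβ⟩ : ![0, 1] ∈ Set.range g := hg ▸ Or.inr (Or.inl rfl)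
  have hmin (γ : PosRoot b) : (g γ ≤ ![1, 0] → ![1, 0] ≤ g γ) ∧
      (g γ ≤ ![0, 1] → ![0, 1] ≤ g γ) := by
    rcases hmem γ with h | h | h | h | h | h <;> rw [h] <;>
      simp only [Pi.le_def] <;> decide
  have hne (γ : PosRoot b) (h1 : γ ≠ α) (h2 : γ ≠ β) :
      g γ ∈ ({![1, 1], ![1, 2], ![1, 3], ![2, 3]} : Set (Fin 2 → ℤ)) := by
    rcases hmem γ with h | h | h
    · exact absurd (hinj (h.trans hα.symm)) h1
    · exact absurd (hinj (h.trans hβ.symm)) h2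
    · exact h
  refine ⟨α, β, ⟨fun h => ?_, fun γ h => ?_, fun γ h => ?_, fun γ h1 h2 => ?_,
    fun γ δ h1 h2 h3 h4 => ?_⟩⟩
  · rw [h, hβ] at hα
    exact absurd hα (by decide)
  · rw [hle, hα] at h ⊢
    exact (hmin γ).1 h
  · rw [hle, hβ] at h ⊢
    exact (hmin γ).2 h
  · have h : ![1, 0] ≤ g γ ∧ ![0, 1] ≤ g γ := by
      rcases hne γ h1 h2 with h | h | h | h <;> rw [h] <;>
      simp only [Pi.le_def] <;> decide
    exact ⟨lt_of_le_of_ne ((hle _ _).2 (hα ▸ h.1)) h1.symm,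
      lt_of_le_of_ne ((hle _ _).2 (hβ ▸ h.2)) h2.symm⟩
  · rw [hle, hle]
    rcases hne γ h1 h2 with h | h | h | h <;> rcases hne δ h3 h4 with h' | h' | h' | h' <;>
      rw [h, h'] <;> simp only [Pi.le_def] <;> decide

theorem IsCoincidentalType.isToggleCDE (hb : IsCoincidentalType b) : IsToggleCDE (PosRoot b) := by
  rcases hb with ⟨n, hA⟩ | ⟨n, hA⟩ | ⟨n, hA⟩ | hA
  · obtain ⟨f, hf⟩ := hA.exists_isStaircase (U := fun _ => n) (isPositiveSystem_A n)
      antitone_const (fun _ => Iff.rfl) fun i j i' j' h1 h2 _ _ => vectorA_le_iff h1 h2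
    exact isToggleCDE_of_isStaircase hf
  · obtain ⟨f, hf⟩ := hA.exists_isStaircase (U := fun i => 2 * n - 1 - i) (isPositiveSystem_B n)
      (fun i j h => by dsimp only; omega) (fun i => by omega)
      fun i j i' j' h1 h2 _ h4 => vectorB_le_iff h1 h2 h4
    exact isToggleCDE_of_isStaircase_half hf
  · obtain ⟨f, hf⟩ := hA.exists_isStaircase (U := fun i => 2 * n - 1 - i) (isPositiveSystem_C n)
      (fun i j h => by dsimp only; omega) (fun i => by omega)
      fun i j i' j' h1 h2 _ h4 => vectorC_le_iff h1 h2 h4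
    exact isToggleCDE_of_isStaircase_half hf
  · obtain ⟨α, β, h⟩ := hA.exists_isDihedral
    exact h.isToggleCDE

end

end RootPosetCDE

theorem mainTheorem4 :
    -- the crystallographic coincidental types `A_n`, `B_n`, `C_n`, `G₂`
    (∀ {ι M N : Type*} [Finite ι] [AddCommGroup M] [Module ℝ M] [AddCommGroup N] [Module ℝ N]
        (Φ : RootPairing ι ℝ M N) [Φ.IsRootSystem] [Φ.IsCrystallographic] [Φ.IsReduced]
        [Φ.IsIrreducible] (b : Φ.Base),
        IsCoincidentalType b → IsToggleCDE (PosRoot b)) ∧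
    -- type `H₃`, with its toggle identity
    (IsToggleCDE RootPosetH3 ∧
      ∀ I : LowerSet RootPosetH3,
        2 * (ddeg I : ℤ) + ∑ p : RootPosetH3, coeffH3 p * toggleability p I = 3) ∧
    -- type `I₂(m)`, with its toggle identity
    (∀ m : ℕ, 2 ≤ m →
      IsToggleCDE (RootPosetI2 m) ∧
      ∀ a b : RootPosetI2 m, a ≠ b → IsMin a → IsMin b →
        ∀ I : LowerSet (RootPosetI2 m),
          2 * (ddeg I : ℤ) + toggleability a I + toggleability b I = 2) := by
  refine ⟨fun Φ _ _ _ _ b hb => hb.isToggleCDE,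
    ⟨isToggleCDE_of_identity coeffH3 3 identity_H3, identity_H3⟩,
    fun m hm => ⟨isToggleCDE_rootPosetI2 hm, fun a b hab ha hb I => ?_⟩⟩
  exact (RootPosetI2.isDihedral hm hab ha hb).identity I
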